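/- Let $S$ be a closed topological surface (a compact Hausdorff $2$-manifold without boundary), let $P\subset S$ be a finite set of $n\ge 0$ points, and suppose that the surface of finite type $\Sigma=S\smallsetminus P$ is connected, orientable and hyperbolic, i.e. that its Euler characteristic $\chi(\Sigma)=2-2g-n$ is negative, where $g$ is the genus of $S$ (so that $2g$ is the rank of $H_1(S;\mathbb{Z})$). Fix an orientation of $\Sigma$ and a base point, and let $\mathrm{Mod}(\Sigma)=\pi_0(\mathrm{Homeo}^+(\Sigma))$ be the mapping class group, i.e. the group of isotopy classes of orientation-preserving homeomorphisms of $\Sigma$, together with its natural homomorphism $\mathrm{Mod}(\Sigma)\to\mathrm{Out}(\pi_1(\Sigma))$. Let $\mathrm{PMod}(\Sigma)\le\mathrm{Mod}(\Sigma)$ be the pure mapping class group, i.e. the kernel of the action of $\mathrm{Mod}(\Sigma)$ on the set $P$ of punctures. Then $\mathrm{PMod}(\Sigma)$ is a congruence subgroup of $\mathrm{Mod}(\Sigma)$: there is a characteristic subgroup $K$ of finite index in $\pi_1(\Sigma)$ such that the kernel of the composite $$\mathrm{Mod}(\Sigma)\to\mathrm{Out}(\pi_1(\Sigma))\to\mathrm{Out}(\pi_1(\Sigma)/K)$$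 is contained in $\mathrm{PMod}(\Sigma)$. -/

import Mathlib

open Set Filter Topology CategoryTheory
open scoped unitInterval

noncomputable section

/-! ### Outer automorphisms and congruence subgroups -/

section Group

instance innNormal (G : Type*) [Group G] : (MulAut.conj : G →* MulAut G).range.Normal where
  conj_mem := by
    rintro _ ⟨g, rfl⟩ φ
    refine ⟨φ g, ?_⟩
    ext x
    simp [MulAut.conj_apply]

/-- The outer automorphism group `Out(G) = Aut(G) / Inn(G)`. -/
abbrev Out (G : Type*) [Group G] : Type _ :=
  MulAut G ⧸ (MulAut.conj : G →* MulAut G).range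

variable {G : Type*} [Group G]

/-- The homomorphism `Aut(G) → Aut(G / K)` for a characteristic subgroup `K`. -/
def autQuotient (K : Subgroup G) [K.Characteristic] : MulAut G →* MulAut (G ⧸ K) where
  toFun φ := QuotientGroup.congr K K φ (Subgroup.characteristic_iff_map_eq.mp ‹_› φ)
  map_one' := by
    ext x
    induction x using QuotientGroup.induction_on
    rfl
  map_mul' φ ψ := by
    ext x
    induction x using QuotientGroup.induction_on
    rfl

/-- The natural homomorphism `Out(G) → Out(G / K)` for a characteristic subgroup `K`. -/
def outQuotient (K : Subgroup G) [K.Characteristic] : Out G →* Out (G ⧸ K) :=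
  QuotientGroup.map _ _ (autQuotient K) (by
    rintro _ ⟨g, rfl⟩
    refine ⟨(g : G ⧸ K), ?_⟩
    ext x
    induction x using QuotientGroup.induction_on
    rfl)

/-- The principal congruence subgroup of `Δ` (acting on `G` by outer automorphisms through `ρ`)
defined by the characteristic quotient `G / K`: the kernel of `Δ → Out(G) → Out(G / K)`. -/
def principalCongruenceSubgroup {Δ : Type*} [Group Δ] (ρ : Δ →* Out G)
    (K : Subgroup G) [K.Characteristic] : Subgroup Δ :=
  ((outQuotient K).comp ρ).ker

/-- A subgroup of `Δ` is a congruence subgroup if it contains the principal congruence subgroup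
defined by some finite characteristic quotient of `G`. -/
def IsCongruenceSubgroup {Δ : Type*} [Group Δ] (ρ : Δ →* Out G) (Γ : Subgroup Δ) : Prop :=
  ∃ (K : Subgroup G) (_ : K.Characteristic),
    K.FiniteIndex ∧ principalCongruenceSubgroup ρ K ≤ Γ

end Group

/-! ### Orientations of topological surfaces -/

section Orientation

/-- A map `g`, defined and injective near `z`, preserves the orientation of the plane at `z`:
the images under `g` of small positively oriented circles about `z` have winding number `+1` about
`g z`. Here `θ` is a continuous choice of the argument of `g - g z` along the circle. -/
def PreservesOrientationAt (g : ℂ → ℂ) (z : ℂ) : Prop :=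
  ∀ᶠ r : ℝ in 𝓝[>] 0, ∃ θ : ℝ → ℝ, ContinuousOn θ (Icc 0 (2 * Real.pi)) ∧
    θ (2 * Real.pi) = θ 0 + 2 * Real.pi ∧
    ∀ t ∈ Icc 0 (2 * Real.pi), g (circleMap z r t) - g z =
      (‖g (circleMap z r t) - g z‖ : ℂ) * Complex.exp (θ t * Complex.I)

/-- Two topological charts of a surface, with values in the plane `ℂ = ℝ²`, are compatibly oriented
if the transition map preserves the orientation at each point where it is defined. -/
def OrientationCompatible {X : Type*} [TopologicalSpace X] (c d : OpenPartialHomeomorph X ℂ) :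
    Prop :=
  ∀ x ∈ c.source ∩ d.source, PreservesOrientationAt (fun z => d (c.symm z)) (c x)

/-- An orientation of a topological surface: a maximal oriented atlas. No smoothness (and nothing
holomorphic) is involved; `ℂ` is only the plane. -/
structure SurfaceOrientation (X : Type*) [TopologicalSpace X] where
  /-- the positively oriented charts -/
  charts : Set (OpenPartialHomeomorph X ℂ)
  covers : ∀ x, ∃ c ∈ charts, x ∈ c.source
  compatible : ∀ c ∈ charts, ∀ d ∈ charts, OrientationCompatible c d
  maximal : ∀ d, (∀ c ∈ charts, OrientationCompatible c d) → d ∈ charts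

variable {X : Type*} [TopologicalSpace X]

/-- The group `Homeo⁺(X)` of homeomorphisms `f` of `X` that preserve the orientation: a chart `c` is
positively oriented if and only if `c ∘ f` is. -/
def homeoPlus (o : SurfaceOrientation X) : Subgroup (X ≃ₜ X) where
  carrier := {f | ∀ c, f.transOpenPartialHomeomorph c ∈ o.charts ↔ c ∈ o.charts}
  one_mem' c := by
    have : (1 : X ≃ₜ X).transOpenPartialHomeomorph c = c := by
      ext <;> rfl
    rw [this]
  mul_mem' {f g} hf hg c := by
    have : (f * g).transOpenPartialHomeomorph c =
        g.transOpenPartialHomeomorph (f.transOpenPartialHomeomorph c) :=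
      Homeomorph.trans_transOpenPartialHomeomorph g f c
    rw [this, hg, hf]
  inv_mem' {f} hf c := by
    rw [← hf]
    have : f.transOpenPartialHomeomorph (f⁻¹.transOpenPartialHomeomorph c) = c := by
      rw [← Homeomorph.trans_transOpenPartialHomeomorph]
      have h : f.trans f⁻¹ = 1 := inv_mul_cancel f
      rw [h]
      ext <;> rfl
    rw [this]

end Orientation

/-! ### The mapping class group -/

section MappingClassGroup

variable {X : Type*} [TopologicalSpace X]

/-- `f` is isotopic to the identity: there is a continuous family of homeomorphisms of `X` from the
identity to `f`. -/
def IsotopicToId (f : X ≃ₜ X) : Prop :=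
  ∃ H : C(I × X, X), (∀ t, IsHomeomorph fun x => H (t, x)) ∧
    (∀ x, H (0, x) = x) ∧ ∀ x, H (1, x) = f x

/-- The subgroup of `Homeo⁺(X)` of homeomorphisms isotopic to the identity. -/
def isotopySubgroup (o : SurfaceOrientation X) : Subgroup (homeoPlus o) where
  carrier := {f | IsotopicToId (f : X ≃ₜ X)}
  one_mem' := ⟨⟨Prod.snd, continuous_snd⟩, fun _ => IsHomeomorph.id, fun _ => rfl, fun _ => rfl⟩
  mul_mem' := by
    rintro ⟨f, _⟩ ⟨g, _⟩ ⟨H, hH, H0, H1⟩ ⟨K, hK, K0, K1⟩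
    refine ⟨⟨fun p => H (p.1, K p), by fun_prop⟩, fun t => (hH t).comp (hK t), fun x => ?_,
      fun x => ?_⟩
    · simp [K0, H0]
    · simp [K1, H1]
  inv_mem' := by
    rintro ⟨f, _⟩ ⟨H, hH, H0, H1⟩
    refine ⟨⟨fun p => f.symm (H (σ p.1, p.2)), by fun_prop⟩,
      fun t => f.symm.isHomeomorph.comp (hH (σ t)), fun x => ?_, fun x => ?_⟩
    · simp at H1
      simp [H1]
    · simp [H0]

instance isotopySubgroup_normal (o : SurfaceOrientation X) : (isotopySubgroup o).Normal where
  conj_mem := by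
    rintro ⟨f, _⟩ ⟨H, hH, H0, H1⟩ ⟨g, _⟩
    refine ⟨⟨fun p => g (H (p.1, g.symm p.2)), by fun_prop⟩,
      fun t => g.isHomeomorph.comp ((hH t).comp g.symm.isHomeomorph), fun x => ?_, fun x => ?_⟩
    · simp [H0]
    · simp at H1
      simp [H1]

/-- The mapping class group `Mod(X) = π₀(Homeo⁺(X))` of an oriented surface: orientation-preserving
homeomorphisms up to isotopy. -/
abbrev MappingClassGroup (o : SurfaceOrientation X) : Type _ :=
  homeoPlus o ⧸ isotopySubgroup o

end MappingClassGroup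

/-! ### The outer action on the fundamental group -/

section OuterAction

variable {X : Type*} [TopologicalSpace X]

/-- The equivalence of fundamental groupoids induced by a homeomorphism. -/
def groupoidEquiv (f : X ≃ₜ X) : FundamentalGroupoid X ≌ FundamentalGroupoid X :=
  CategoryTheory.Equivalence.mk (FundamentalGroupoid.map (f : C(X, X)))
    (FundamentalGroupoid.map (f.symm : C(X, X)))
    (eqToIso (by
      rw [← FundamentalGroupoid.map_comp, ← FundamentalGroupoid.map_id]
      congr 1; ext x; simp))
    (eqToIso (by
      rw [← FundamentalGroupoid.map_comp, ← FundamentalGroupoid.map_id]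
      congr 1; ext x; simp))

/-- The automorphism `[α] ↦ [γ · f(α) · γ⁻¹]` of `π₁(X, x₀)` determined by a homeomorphism `f` and a
homotopy class `γ` of paths from `x₀` to `f x₀`. -/
def pushAut (f : X ≃ₜ X) {x₀ : X}
    (γ : FundamentalGroupoid.mk x₀ ⟶ FundamentalGroupoid.mk (f x₀)) :
    MulAut (FundamentalGroup X x₀) :=
  ((groupoidEquiv f).fullyFaithfulFunctor.mulEquivEnd (FundamentalGroupoid.mk x₀)).trans
    ((Groupoid.isoEquivHom _ _).symm γ).symm.conj

theorem pushAut_apply (f : X ≃ₜ X) {x₀ : X}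
    (γ : FundamentalGroupoid.mk x₀ ⟶ FundamentalGroupoid.mk (f x₀))
    (α : FundamentalGroup X x₀) :
    pushAut f γ α = γ ≫ (FundamentalGroupoid.map (f : C(X, X))).map α ≫ Groupoid.inv γ :=
  rfl

theorem groupoid_conj_change {C : Type*} [Groupoid C] {a b : C} (γ γ' : a ⟶ b) (β : b ⟶ b) :
    γ ≫ β ≫ Groupoid.inv γ =
      (γ ≫ Groupoid.inv γ') ≫ (γ' ≫ β ≫ Groupoid.inv γ') ≫ (γ' ≫ Groupoid.inv γ) := by
  simp

theorem groupoid_conj_comp {C : Type*} [Groupoid C] (F : C ⥤ C) {a b : C} (γ : a ⟶ F.obj a)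
    (δ : a ⟶ b) (β : b ⟶ b) :
    (γ ≫ F.map δ) ≫ F.map β ≫ Groupoid.inv (γ ≫ F.map δ) =
      γ ≫ F.map (δ ≫ β ≫ Groupoid.inv δ) ≫ Groupoid.inv γ := by
  simp

theorem groupoid_conj_natural {C : Type*} [Groupoid C] {a b : C} (γ : a ⟶ b) (α : a ⟶ a)
    (β : b ⟶ b) (h : α ≫ γ = γ ≫ β) : γ ≫ β ≫ Groupoid.inv γ = α := by
  rw [← Category.assoc, ← h]
  simp

theorem mk_pushAut_eq (f : X ≃ₜ X) {x₀ : X}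
    (γ γ' : FundamentalGroupoid.mk x₀ ⟶ FundamentalGroupoid.mk (f x₀)) :
    (QuotientGroup.mk (pushAut f γ) : Out (FundamentalGroup X x₀)) =
      QuotientGroup.mk (pushAut f γ') := by
  rw [eq_comm, QuotientGroup.eq]
  let g : FundamentalGroup X x₀ := γ' ≫ Groupoid.inv γ
  have hg : g⁻¹ = γ ≫ Groupoid.inv γ' :=
    inv_eq_of_mul_eq_one_left (by simp [g, End.mul_def, End.one_def])
  have key : pushAut f γ = MulAut.conj g * pushAut f γ' := by
    ext α
    rw [MulAut.mul_apply, MulAut.conj_apply, hg]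
    exact groupoid_conj_change γ γ' _
  rw [key, ← mul_assoc]
  simpa using (innNormal (FundamentalGroup X x₀)).conj_mem _ ⟨g, rfl⟩ (pushAut f γ')⁻¹

theorem pushAut_mul (f g : X ≃ₜ X) {x₀ : X}
    (γ : FundamentalGroupoid.mk x₀ ⟶ FundamentalGroupoid.mk (f x₀))
    (δ : FundamentalGroupoid.mk x₀ ⟶ FundamentalGroupoid.mk (g x₀)) :
    pushAut (f * g) (γ ≫ (FundamentalGroupoid.map (f : C(X, X))).map δ) =
      pushAut f γ * pushAut g δ := by
  ext α
  have h : (FundamentalGroupoid.map ((f * g : X ≃ₜ X) : C(X, X))).map α =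
      (FundamentalGroupoid.map (f : C(X, X))).map
        ((FundamentalGroupoid.map (g : C(X, X))).map α) := by
    obtain ⟨a, rfl⟩ := Path.Homotopic.Quotient.mk_surjective α
    rfl
  rw [MulAut.mul_apply, pushAut_apply, pushAut_apply, pushAut_apply, h]
  exact groupoid_conj_comp (FundamentalGroupoid.map (f : C(X, X))) γ δ _

theorem pushAut_isotopicToId (f : X ≃ₜ X) (x₀ : X) (hf : IsotopicToId f) :
    ∃ γ : FundamentalGroupoid.mk x₀ ⟶ FundamentalGroupoid.mk (f x₀), pushAut f γ = 1 := by
  obtain ⟨H, -, H0, H1⟩ := hf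
  let F : ContinuousMap.Homotopy (ContinuousMap.id X) (f : C(X, X)) := ⟨H, H0, H1⟩
  let η := FundamentalGroupoidFunctor.homotopicMapsNatIso F
  refine ⟨η.app ⟨x₀⟩, ?_⟩
  ext α
  have h := η.naturality (X := ⟨x₀⟩) (Y := ⟨x₀⟩) α
  have h' : (FundamentalGroupoid.map (ContinuousMap.id X)).map α = α := by
    obtain ⟨a, rfl⟩ := Path.Homotopic.Quotient.mk_surjective α
    rfl
  rw [h'] at h
  exact groupoid_conj_natural (C := FundamentalGroupoid X) (a := ⟨x₀⟩) (b := ⟨f x₀⟩) _ α _ h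

variable [PathConnectedSpace X]

/-- The natural homomorphism `Homeo(X) → Out(π₁(X, x₀))`. It sends `f` to the class of
`[α] ↦ [γ · f(α) · γ⁻¹]`, where the choice of the path `γ` from `x₀` to `f x₀` does not matter. -/
def homeoOuterAction (x₀ : X) : (X ≃ₜ X) →* Out (FundamentalGroup X x₀) :=
  MonoidHom.mk' (fun f => QuotientGroup.mk (pushAut f
    (FundamentalGroupoid.fromPath (.mk (PathConnectedSpace.somePath x₀ (f x₀)))))) (by
      intro f g
      rw [← QuotientGroup.mk_mul, ← pushAut_mul]
      exact mk_pushAut_eq _ _ _)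

/-- The natural homomorphism `Mod(X) → Out(π₁(X, x₀))`. -/
def outerAction (o : SurfaceOrientation X) (x₀ : X) :
    MappingClassGroup o →* Out (FundamentalGroup X x₀) :=
  QuotientGroup.lift (isotopySubgroup o) ((homeoOuterAction x₀).comp (homeoPlus o).subtype) (by
    rintro ⟨f, _⟩ hf
    obtain ⟨γ, hγ⟩ := pushAut_isotopicToId f x₀ hf
    refine (mk_pushAut_eq f _ γ).trans ?_
    rw [hγ]
    rfl)

end OuterAction

/-! ### Surfaces of finite type -/

section FiniteType

/-- The surface obtained from a closed surface `S` by deleting the finite set `P` of points. -/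
abbrev Punctured (S : Type*) (P : Finset S) : Type _ := {x : S // x ∉ P}

variable {S : Type*} [TopologicalSpace S]

instance punctured_pathConnectedSpace [T1Space S] [ChartedSpace ℂ S] (P : Finset S)
    [ConnectedSpace (Punctured S P)] : PathConnectedSpace (Punctured S P) := by
  have : LocallyPathConnectedSpace S := ChartedSpace.locallyPathConnectedSpace ℂ S
  have ho : IsOpen {x : S | x ∉ P} := P.finite_toSet.isClosed.isOpen_compl
  have : LocallyPathConnectedSpace (Punctured S P) := ho.locallyPathConnectedSpace
  exact PathConnectedSpace.of_locallyPathConnectedSpace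

/-- The first Betti number of `S`, i.e. the rank of `H₁(S; ℤ)`, the abelianization of
`π₁(S, x)`. For a closed connected orientable surface of genus `g` it equals `2g`. -/
def firstBetti (S : Type*) [TopologicalSpace S] (x : S) : ℕ :=
  Module.finrank ℤ (Additive (Abelianization (FundamentalGroup S x)))

/-- The Euler characteristic `2 - 2g - n` of a closed connected orientable surface `S` with a set
`P` of `n` points deleted. (The base point `x` serves only to compute `2g`.) -/
def eulerCharPunctured (P : Finset S) (x : S) : ℤ :=
  2 - (firstBetti S x : ℤ) - (P.card : ℤ)

/-- The trace on `S ∖ P` of the filter of neighbourhoods of the puncture `p`. -/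
def punctureFilter (P : Finset S) (p : S) : Filter (Punctured S P) :=
  comap Subtype.val (𝓝 p)

/-- The orientation-preserving homeomorphisms of `S ∖ P` that fix each puncture: `f x` tends to `p`
if and only if `x` does. -/
def homeoFixingPunctures (P : Finset S) (o : SurfaceOrientation (Punctured S P)) :
    Subgroup (homeoPlus o) where
  carrier := {f | ∀ p ∈ P, map (f : Punctured S P ≃ₜ Punctured S P) (punctureFilter P p) =
    punctureFilter P p}
  one_mem' _ _ := map_id
  mul_mem' {f g} hf hg p hp := by
    have h : map ((f * g : homeoPlus o) : Punctured S P ≃ₜ Punctured S P) (punctureFilter P p) =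
      map (f : Punctured S P ≃ₜ Punctured S P) (map (g : Punctured S P ≃ₜ Punctured S P)
        (punctureFilter P p)) := (map_map).symm
    rw [h, hg p hp, hf p hp]
  inv_mem' {f} hf p hp := by
    have h : map ((f⁻¹ : homeoPlus o) : Punctured S P ≃ₜ Punctured S P)
        (map (f : Punctured S P ≃ₜ Punctured S P) (punctureFilter P p)) = punctureFilter P p := by
      rw [map_map]
      convert map_id
      ext x
      simp
    rwa [hf p hp] at h

/-- The pure mapping class group `PMod(S ∖ P)`: the mapping classes that act trivially on the set of
punctures. Isotopic homeomorphisms induce the same permutation of the punctures, so one representative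
of a class fixes every puncture if and only if all of them do. -/
def pureMappingClassGroup (P : Finset S) (o : SurfaceOrientation (Punctured S P)) :
    Subgroup (MappingClassGroup o) :=
  (homeoFixingPunctures P o).map (QuotientGroup.mk' (isotopySubgroup o))

end FiniteType

end

/-!
A homeomorphism of `Σ` permutes the ends of `Σ`, and if it preserves the orientation, then its
extension over a puncture has local degree `1`. Suppose that it moves a puncture `p` to `q ≠ p`.
Some embedded plane contains both `p` and `q`, and in its coordinate the function
`(z - p) / (z - q)`, which tends to `1` at infinity, extends to a nowhere vanishing function on `Σ`.
This function winds once around the origin along a small loop about `p`, and `-1` times along the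
image of this loop, which is a loop about `q`.

Winding numbers modulo `3` therefore give a homomorphism `φ : π₁(Σ) → ℤ/3` and a loop `α` such
that `φ` takes the values `1` and `-1 ≠ 1` at `α` and its image. As `π₁(Σ)` is finitely
generated, the intersection `K` of the kernels of all homomorphisms to `ℤ/3` has finite index,
and it is characteristic. An automorphism which is inner modulo `K` does not change the values of
homomorphisms to `ℤ/3`, so the mapping class is not in the kernel of the map to `Out(π₁(Σ)/K)`.
-/

noncomputable section

theorem sub_eq_sub_of_exp_eq {Y : Type*} [TopologicalSpace Y] {s : Set Y} (hs : IsPreconnected s)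
    {F G : Y → ℂ} (hF : ContinuousOn F s) (hG : ContinuousOn G s)
    (h : ∀ y ∈ s, Complex.exp (F y) = Complex.exp (G y)) {x y : Y} (hx : x ∈ s) (hy : y ∈ s) :
    F y - F x = G y - G x := by
  let periods : AddSubgroup ℂ := AddSubgroup.zmultiples (2 * Real.pi * Complex.I)
  have hdiscrete : IsDiscrete (periods : Set ℂ) := ⟨NormedSpace.discreteTopology_zmultiples _⟩
  have hmaps : MapsTo (F - G) s periods := fun z hz => by
    obtain ⟨m, hm⟩ := Complex.exp_eq_exp_iff_exists_int.mp (h z hz)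
    exact ⟨m, by simp [hm]⟩
  have hconst := hs.constant_of_mapsTo hdiscrete (hF.sub hG) hmaps hx hy
  simp only [Pi.sub_apply] at hconst
  linear_combination -hconst

theorem exists_continuousOn_log_of_convex {E : Type*} [NormedAddCommGroup E] [NormedSpace ℝ E]
    {U : Set E} (hU : Convex ℝ U) (hne : U.Nonempty) (ho : IsOpen U) {g : E → ℂ}
    (hg : ContinuousOn g U) (h0 : ∀ x ∈ U, g x ≠ 0) :
    ∃ L : E → ℂ, ContinuousOn L U ∧ ∀ x ∈ U, Complex.exp (L x) = g x := by
  have : ContractibleSpace U := hU.contractibleSpace hne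
  have hs : IsSimplyConnected U := inferInstanceAs (SimplyConnectedSpace U)
  exact Complex.exists_continuousOn_eqOn_exp_comp hs ho hg fun ⟨x, hx, hx0⟩ => h0 x hx hx0

/-- The local degree of a map `g` of the plane at a point `z` near which `g` takes the value `g z`
only at `z`. It is read off in the logarithmic coordinate `ζ ↦ z + exp ζ`, where `g - g z` has a
continuous logarithm `Φ` on a left half-plane: going once around `z` increases `Φ` by `2πin`. -/
def HasLocalDegree (g : ℂ → ℂ) (z : ℂ) (n : ℤ) : Prop :=
  ∃ (a : ℝ) (Φ : ℂ → ℂ), ContinuousOn Φ {ζ | ζ.re < a} ∧ ∀ ζ : ℂ, ζ.re < a →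
    Complex.exp (Φ ζ) = g (z + Complex.exp ζ) - g z ∧
      Φ (ζ + 2 * Real.pi * Complex.I) = Φ ζ + n * (2 * Real.pi * Complex.I)

theorem tendsto_add_exp_comap_re_atBot (z : ℂ) :
    Tendsto (fun ζ => z + Complex.exp ζ) (comap Complex.re atBot) (𝓝 z) := by
  simpa using tendsto_const_nhds.add (Complex.tendsto_exp_nhds_zero_iff.mpr tendsto_comap)

theorem eventually_comap_re_atBot_iff {p : ℂ → Prop} :
    (∀ᶠ ζ in comap Complex.re atBot, p ζ) ↔ ∃ a : ℝ, ∀ ζ : ℂ, ζ.re < a → p ζ :=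
  (atBot_basis_Iio.comap Complex.re).eventually_iff.trans (by simp)

theorem apply_add_int_mul_two_pi_I {Φ : ℂ → ℂ} {a : ℝ} {n : ℤ}
    (h : ∀ ζ : ℂ, ζ.re < a →
      Φ (ζ + 2 * Real.pi * Complex.I) = Φ ζ + n * (2 * Real.pi * Complex.I))
    (k : ℤ) {ζ : ℂ} (hζ : ζ.re < a) :
    Φ (ζ + k * (2 * Real.pi * Complex.I)) = Φ ζ + n * k * (2 * Real.pi * Complex.I) := by
  induction k with
  | zero => simp
  | succ i ih =>
    have := h (ζ + i * (2 * Real.pi * Complex.I)) (by simpa using hζ)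
    push_cast at ih ⊢
    rw [add_mul, one_mul, ← add_assoc, this, ih]
    ring
  | pred i ih =>
    have := h (ζ + (-i - 1) * (2 * Real.pi * Complex.I)) (by simpa using hζ)
    push_cast at ih ⊢
    rw [show ζ + (-(i : ℂ) - 1) * (2 * Real.pi * Complex.I) + 2 * Real.pi * Complex.I =
      ζ + -(i : ℂ) * (2 * Real.pi * Complex.I) by ring, ih] at this
    linear_combination -this

namespace HasLocalDegree

variable {g h : ℂ → ℂ} {z : ℂ} {m n : ℤ}

theorem id (z : ℂ) : HasLocalDegree (fun w => w) z 1 :=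
  ⟨0, fun ζ => ζ, continuousOn_id, fun ζ _ => by simp⟩

theorem unique (hm : HasLocalDegree g z m) (hn : HasLocalDegree g z n) : m = n := by
  obtain ⟨a, Φ, hΦ, hΦg⟩ := hm
  obtain ⟨b, Ψ, hΨ, hΨg⟩ := hn
  have hconn : IsPreconnected {ζ : ℂ | ζ.re < min a b} := (convex_halfSpace_re_lt _).isPreconnected
  obtain ⟨ζ, hζ⟩ : ∃ ζ : ℂ, ζ.re < min a b := ⟨(min a b - 1 : ℝ), sub_one_lt _⟩
  have hsub := sub_eq_sub_of_exp_eq hconn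
    (hΦ.mono fun η hη => lt_of_lt_of_le hη (min_le_left a b))
    (hΨ.mono fun η hη => lt_of_lt_of_le hη (min_le_right a b))
    (fun η hη => by rw [(hΦg η (lt_min_iff.mp hη).1).1, (hΨg η (lt_min_iff.mp hη).2).1])
    hζ (y := ζ + 2 * Real.pi * Complex.I) (by simpa using hζ)
  rw [(hΦg ζ (lt_min_iff.mp hζ).1).2, (hΨg ζ (lt_min_iff.mp hζ).2).2, add_sub_cancel_left,
    add_sub_cancel_left] at hsub
  exact_mod_cast mul_right_cancel₀ Complex.two_pi_I_ne_zero hsub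

theorem congr (hn : HasLocalDegree g z n) (hgh : g =ᶠ[𝓝 z] h) : HasLocalDegree h z n := by
  obtain ⟨a, Φ, hΦ, hΦg⟩ := hn
  obtain ⟨b, hb⟩ := eventually_comap_re_atBot_iff.mp
    ((tendsto_add_exp_comap_re_atBot z).eventually hgh)
  refine ⟨min a b, Φ, hΦ.mono fun ζ hζ => lt_of_lt_of_le hζ (min_le_left a b), fun ζ hζ => ?_⟩
  rw [lt_min_iff] at hζ
  rw [← hb ζ hζ.2, ← hgh.eq_of_nhds]
  exact hΦg ζ hζ.1

theorem comp (hh : HasLocalDegree h (g z) n) (hg : HasLocalDegree g z m) (hgc : ContinuousAt g z) :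
    HasLocalDegree (fun w => h (g w)) z (n * m) := by
  obtain ⟨a, Φ, hΦ, hΦg⟩ := hg
  obtain ⟨b, Ψ, hΨ, hΨh⟩ := hh
  have hexp : Tendsto (fun ζ => g (z + Complex.exp ζ) - g z) (comap Complex.re atBot) (𝓝 0) := by
    simpa using (hgc.tendsto.comp (tendsto_add_exp_comap_re_atBot z)).sub_const (g z)
  obtain ⟨c, hc⟩ : ∃ c : ℝ, ∀ ζ : ℂ, ζ.re < c → ‖g (z + Complex.exp ζ) - g z‖ < Real.exp b := by
    rw [← eventually_comap_re_atBot_iff]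
    simpa using hexp.norm.eventually_lt_const (by simpa using Real.exp_pos b)
  have hre : ∀ ζ : ℂ, ζ.re < min a c → (Φ ζ).re < b := by
    intro ζ hζ
    rw [lt_min_iff] at hζ
    rw [← Real.exp_lt_exp, ← Complex.norm_exp, (hΦg ζ hζ.1).1]
    exact hc ζ hζ.2
  refine ⟨min a c, fun ζ => Ψ (Φ ζ), hΨ.comp (hΦ.mono ?_) hre, fun ζ hζ => ⟨?_, ?_⟩⟩
  · exact fun ζ hζ => lt_of_lt_of_le hζ (min_le_left a c)
  · rw [(hΨh _ (hre ζ hζ)).1, (hΦg ζ (lt_min_iff.mp hζ).1).1, add_sub_cancel]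
  · dsimp only
    rw [(hΦg ζ (lt_min_iff.mp hζ).1).2,
      apply_add_int_mul_two_pi_I (fun η hη => (hΨh η hη).2) m (hre ζ hζ)]
    push_cast
    rfl

end HasLocalDegree

theorem convex_setOf_dist_add_exp_re_lt (z₀ : ℂ) (R : ℝ) :
    Convex ℝ {p : ℂ × ℂ | dist p.1 z₀ + Real.exp p.2.re < R} := by
  have hdist : ConvexOn ℝ univ fun p : ℂ × ℂ => dist p.1 z₀ :=
    (convexOn_univ_dist z₀).comp_linearMap (LinearMap.fst ℝ ℂ ℂ)
  have hexp : ConvexOn ℝ univ fun p : ℂ × ℂ => Real.exp p.2.re :=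
    convexOn_exp.comp_linearMap (Complex.reLm ∘ₗ LinearMap.snd ℝ ℂ ℂ)
  simpa using (hdist.add hexp).convex_lt R

-- The logarithm of `g (z + exp ζ) - g z` exists on a convex set of pairs `(z, ζ)`; continuity in
-- both variables makes its period independent of `z`.
theorem exists_eventually_hasLocalDegree {g : ℂ → ℂ} {U : Set ℂ} {z₀ : ℂ} (hU : U ∈ 𝓝 z₀)
    (hg : ContinuousOn g U) (hi : InjOn g U) : ∃ n, ∀ᶠ z in 𝓝 z₀, HasLocalDegree g z n := by
  obtain ⟨R, hR, hRU⟩ := Metric.mem_nhds_iff.mp hU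
  let T : Set (ℂ × ℂ) := {p | dist p.1 z₀ + Real.exp p.2.re < R}
  have hTconv : Convex ℝ T := convex_setOf_dist_add_exp_re_lt z₀ R
  have hTopen : IsOpen T := isOpen_lt (by fun_prop) continuous_const
  have hbase : (z₀, (Real.log (R / 2) : ℂ)) ∈ T := by
    simp [T, Real.exp_log (half_pos hR), hR]
  have hcircle : MapsTo (fun p : ℂ × ℂ => p.1 + Complex.exp p.2) T U := fun p hp => hRU <| by
    rw [Metric.mem_ball, dist_eq_norm, add_sub_right_comm]
    exact (norm_add_le _ _).trans_lt (by simpa [T, Complex.norm_exp, dist_eq_norm] using hp)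
  have hcenter : MapsTo Prod.fst T U := fun p hp => hRU <|
    (lt_add_of_pos_right _ (Real.exp_pos _)).trans hp
  obtain ⟨L, hL, hLg⟩ := exists_continuousOn_log_of_convex hTconv ⟨_, hbase⟩ hTopen
    (g := fun p => g (p.1 + Complex.exp p.2) - g p.1)
    ((hg.comp (by fun_prop) hcircle).sub (hg.comp continuousOn_fst hcenter))
    (fun p hp h => by simpa using hi (hcircle hp) (hcenter hp) (sub_eq_zero.mp h))
  let turn : ℂ × ℂ → ℂ × ℂ := fun p => (p.1, p.2 + 2 * Real.pi * Complex.I)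
  have hturn : MapsTo turn T T := fun p hp => by simpa [T, turn] using hp
  have hexp : ∀ p ∈ T, Complex.exp (L (turn p)) = Complex.exp (L p) := fun p hp => by
    rw [hLg _ (hturn hp), hLg p hp, Complex.exp_periodic p.2]
  obtain ⟨n, hn⟩ := Complex.exp_eq_exp_iff_exists_int.mp (hexp _ hbase)
  refine ⟨n, Metric.eventually_nhds_iff_ball.mpr ⟨R, hR, fun z hz => ?_⟩⟩
  have hT : ∀ ζ : ℂ, ζ.re < Real.log (R - dist z z₀) → (z, ζ) ∈ T := fun ζ hζ => by
    exact lt_sub_iff_add_lt'.mp ((Real.lt_log_iff_exp_lt (sub_pos.mpr hz)).mp hζ)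
  refine ⟨Real.log (R - dist z z₀), fun ζ => L (z, ζ), hL.comp (by fun_prop) hT,
    fun ζ hζ => ⟨hLg _ (hT ζ hζ), ?_⟩⟩
  have := sub_eq_sub_of_exp_eq hTconv.isPreconnected
    (hL.comp (by fun_prop : Continuous turn).continuousOn hturn) hL hexp hbase (hT ζ hζ)
  simp only [Function.comp_apply, turn] at this hn
  linear_combination this + hn

theorem hasLocalDegree_of_frequently {g : ℂ → ℂ} {U : Set ℂ} {z : ℂ} {n : ℤ} (hU : U ∈ 𝓝 z)
    (hg : ContinuousOn g U) (hi : InjOn g U) (hn : ∃ᶠ w in 𝓝 z, HasLocalDegree g w n) :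
    HasLocalDegree g z n := by
  obtain ⟨m, hm⟩ := exists_eventually_hasLocalDegree hU hg hi
  obtain ⟨w, hwn, hwm⟩ := (hn.and_eventually hm).exists
  exact hwn.unique hwm ▸ hm.self_of_nhds

theorem PreservesOrientationAt.hasLocalDegree {g : ℂ → ℂ} {z : ℂ} (h : PreservesOrientationAt g z)
    {U : Set ℂ} (hU : U ∈ 𝓝 z) (hg : ContinuousOn g U) (hi : InjOn g U) :
    HasLocalDegree g z 1 := by
  obtain ⟨n, hn⟩ := exists_eventually_hasLocalDegree hU hg hi
  obtain ⟨a, Φ, hΦ, hΦg⟩ := hn.self_of_nhds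
  obtain ⟨r, ⟨θ, hθ, hθturn, hθg⟩, hr, hra⟩ :=
    (h.and (Ioo_mem_nhdsGT (Real.exp_pos a))).exists
  let ℓ : ℝ → ℂ := fun t => Real.log r + t * Complex.I
  have hℓ : ∀ t, (ℓ t).re < a := fun t => by simpa [ℓ] using (Real.log_lt_iff_lt_exp hr).mpr hra
  have hcircle : ∀ t, Complex.exp (Φ (ℓ t)) = g (circleMap z r t) - g z := fun t => by
    rw [(hΦg _ (hℓ t)).1, circleMap, Complex.exp_add, ← Complex.ofReal_exp, Real.exp_log hr]
  have hnorm : ∀ t, ‖g (circleMap z r t) - g z‖ = Real.exp (Φ (ℓ t)).re := fun t => by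
    rw [← hcircle, Complex.norm_exp]
  have hΦℓ : Continuous fun t => Φ (ℓ t) := hΦ.comp_continuous (by fun_prop) hℓ
  have hpolar : ∀ t ∈ Icc 0 (2 * Real.pi),
      Complex.exp ((Φ (ℓ t)).re + θ t * Complex.I) = Complex.exp (Φ (ℓ t)) := fun t ht => by
    rw [Complex.exp_add, ← Complex.ofReal_exp, ← hnorm, ← hθg t ht, hcircle]
  have hsub := sub_eq_sub_of_exp_eq isPreconnected_Icc
    (((Complex.continuous_ofReal.comp
      (Complex.continuous_re.comp hΦℓ)).continuousOn).add (by fun_prop)) hΦℓ.continuousOn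
    hpolar (left_mem_Icc.mpr Real.two_pi_pos.le) (right_mem_Icc.mpr Real.two_pi_pos.le)
  have hturn : Φ (ℓ (2 * Real.pi)) = Φ (ℓ 0) + n * (2 * Real.pi * Complex.I) := by
    rw [← (hΦg _ (hℓ 0)).2]
    simp [ℓ]
  have hturn_re : (Φ (ℓ (2 * Real.pi))).re = (Φ (ℓ 0)).re := by simp [hturn]
  have : (n : ℂ) = 1 := by
    refine mul_right_cancel₀ Complex.two_pi_I_ne_zero ?_
    simp only [Pi.add_apply, Function.comp_apply, hturn_re, hθturn] at hsub
    rw [hturn] at hsub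
    push_cast at hsub
    linear_combination -hsub
  obtain rfl : n = 1 := by exact_mod_cast this
  exact hn.self_of_nhds

section EmbeddedSpaces

variable {E S : Type*} [NormedAddCommGroup E] [NormedSpace ℝ E] [TopologicalSpace S]

theorem exists_isOpenEmbedding_range_subset [ChartedSpace E S] {y : S} {O : Set S} (hO : O ∈ 𝓝 y) :
    ∃ e : E → S, IsOpenEmbedding e ∧ e 0 = y ∧ range e ⊆ O := by
  let c := chartAt E y
  have hy : y ∈ c.source := mem_chart_source E y
  have hnhds : c.target ∩ c.symm ⁻¹' O ∈ 𝓝 (c y) :=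
    inter_mem (c.open_target.mem_nhds (c.map_source hy))
      ((c.continuousAt_symm (c.map_source hy)).preimage_mem_nhds (by rwa [c.left_inv hy]))
  obtain ⟨r, hr, hball⟩ := Metric.mem_nhds_iff.mp hnhds
  have hmem : ∀ z : E, OpenPartialHomeomorph.univBall (c y) r z ∈ Metric.ball (c y) r := fun z => by
    rw [← OpenPartialHomeomorph.univBall_target _ hr]
    exact OpenPartialHomeomorph.map_source _ (by simp)
  let b := (OpenPartialHomeomorph.univBall (c y) r).trans c.symm
  have hsource : b.source = univ := by
    ext z
    simpa [b] using (hball (hmem z)).1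
  refine ⟨b, b.isOpenEmbedding hsource, ?_, ?_⟩
  · simp [b, hy]
  · rintro _ ⟨z, rfl⟩
    exact (hball (hmem z)).2

theorem comap_nhds_le_cocompact {X : Type*} [TopologicalSpace X] [T2Space S] {e : X → S}
    (he : Continuous e) {x : S} (hx : x ∉ range e) : comap e (𝓝 x) ≤ cocompact X := by
  refine (hasBasis_cocompact.ge_iff).mpr fun K hK => ?_
  refine mem_comap.mpr ⟨(e '' K)ᶜ, (hK.image he).isClosed.isOpen_compl.mem_nhds ?_, ?_⟩
  · exact fun h => hx (image_subset_range e K h)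
  · exact fun z hz hzK => hz (mem_image_of_mem e hzK)

variable {X Y : Type*} [TopologicalSpace Y] {e : X → S} {g : X → Y} {d : S → Y}

theorem continuousAt_extend_apply [TopologicalSpace X] (he : IsOpenEmbedding e) {z : X}
    (hg : ContinuousAt g z) : ContinuousAt (Function.extend e g d) (e z) := by
  rwa [← he.continuousAt_iff, Function.extend_comp he.injective]

theorem continuousAt_extend_of_notMem_range (he : Function.Injective e) {x : S} (hx : x ∉ range e)
    (hd : ContinuousAt d x) (hg : Tendsto g (comap e (𝓝 x)) (𝓝 (d x))) :
    ContinuousAt (Function.extend e g d) x := by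
  rw [ContinuousAt, Function.extend_apply' _ _ _ hx]
  intro W hW
  have hgW : ∀ᶠ y in 𝓝 x, ∀ ⦃z⦄, e z = y → g z ∈ W := mem_comap'.mp (hg.eventually hW)
  rw [mem_map]
  filter_upwards [hd hW, hgW] with y hdy hgy
  by_cases hy : y ∈ range e
  · obtain ⟨z, rfl⟩ := hy
    rw [mem_preimage, he.extend_apply]
    exact hgy rfl
  · rw [mem_preimage, Function.extend_apply' _ _ _ hy]
    exact hdy

theorem exists_homeomorph_add_of_lipschitzWith [CompleteSpace E] {K : NNReal} {f : E → E}
    (hK : K < 1) (hf : LipschitzWith K f) : ∃ k : E ≃ₜ E, ∀ z, k z = z + f z := by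
  have happrox : ApproximatesLinearOn (fun z => z + f z)
      ((ContinuousLinearEquiv.refl ℝ E : E ≃L[ℝ] E) : E →L[ℝ] E) univ K := by
    rw [ApproximatesLinearOn.approximatesLinearOn_iff_lipschitzOnWith, lipschitzOnWith_univ]
    convert hf
    ext z
    simp
  refine ⟨happrox.toHomeomorph _ ?_, fun z => rfl⟩
  rcases subsingleton_or_nontrivial E with hE | hE
  · exact Or.inl hE
  · right
    rw [ContinuousLinearEquiv.refl_symm, ContinuousLinearEquiv.coe_refl,
      ContinuousLinearMap.nnnorm_id, inv_one]
    exact hK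

-- The displacement is a tent function with Lipschitz constant less than `1`.
theorem exists_homeomorph_apply_eq_of_cocompact [ProperSpace E] (a b : E) :
    ∃ k : E ≃ₜ E, k a = b ∧ ∀ᶠ z in cocompact E, k z = z := by
  let ρ : ℝ := ‖b - a‖ + 1
  have hρ : 0 < ρ := by positivity
  let v : E := ρ⁻¹ • (b - a)
  have hbump : LipschitzWith (0 + 1) fun z => max 0 (ρ - dist z a) :=
    ((LipschitzWith.const ρ).sub (LipschitzWith.dist_left a)).const_max 0
  have hv : ‖ContinuousLinearMap.toSpanSingleton ℝ v‖₊ * (0 + 1) < 1 := by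
    rw [zero_add, mul_one, ← NNReal.coe_lt_coe, coe_nnnorm,
      ContinuousLinearMap.norm_toSpanSingleton, norm_smul, norm_inv,
      Real.norm_of_nonneg hρ.le, NNReal.coe_one, inv_mul_lt_one₀ hρ]
    exact lt_add_one _
  obtain ⟨k, hk⟩ := exists_homeomorph_add_of_lipschitzWith hv
    ((ContinuousLinearMap.toSpanSingleton ℝ v).lipschitz.comp hbump)
  refine ⟨k, ?_, ?_⟩
  · simp [hk, v, hρ.le, hρ.ne']
  · filter_upwards [(tendsto_dist_right_cocompact_atTop a).eventually_ge_atTop ρ] with z hz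
    simp [hk, hz]

theorem exists_homeomorph_apply_eq_of_mem_range [ProperSpace E] [T2Space S] {e : E → S}
    (he : IsOpenEmbedding e) (a b : E) :
    ∃ h : S ≃ₜ S, h (e a) = e b ∧ ∀ x ∉ range e, h x = x := by
  obtain ⟨k, hkab, hk⟩ := exists_homeomorph_apply_eq_of_cocompact a b
  have hcont : ∀ l : E ≃ₜ E, (∀ᶠ z in cocompact E, l z = z) →
      Continuous (Function.extend e (e ∘ l) id) := fun l hl => by
    refine continuous_iff_continuousAt.mpr fun x => ?_
    by_cases hx : x ∈ range e
    · obtain ⟨z, rfl⟩ := hx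
      exact continuousAt_extend_apply he (he.continuous.comp l.continuous).continuousAt
    · refine continuousAt_extend_of_notMem_range he.injective hx continuousAt_id ?_
      refine Tendsto.congr' ?_ (tendsto_comap (f := e))
      filter_upwards [comap_nhds_le_cocompact he.continuous hx hl] with z hz
      exact (congrArg e hz).symm
  have hinv : ∀ l : E ≃ₜ E, Function.LeftInverse (Function.extend e (e ∘ l.symm) id)
      (Function.extend e (e ∘ l) id) := fun l x => by
    by_cases hx : x ∈ range e
    · obtain ⟨z, rfl⟩ := hx
      simp [he.injective.extend_apply]
    · simp [Function.extend_apply' _ _ _ hx]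
  refine ⟨⟨⟨Function.extend e (e ∘ k) id, Function.extend e (e ∘ k.symm) id, hinv k, hinv k.symm⟩,
    hcont k hk, hcont k.symm (hk.mono fun z hz => by rw [k.symm_apply_eq, hz])⟩, ?_, fun x hx => ?_⟩
  · exact (he.injective.extend_apply _ _ _).trans (congrArg e hkab)
  · exact Function.extend_apply' _ _ _ hx

theorem exists_isOpenEmbedding_pair_mem_range [FiniteDimensional ℝ E] [ChartedSpace E S] [T2Space S]
    [PreconnectedSpace S] (p q : S) :
    ∃ e : E → S, IsOpenEmbedding e ∧ p ∈ range e ∧ q ∈ range e := by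
  have : ProperSpace E := FiniteDimensional.proper ℝ E
  let P : S → S → Prop := fun p q => ∃ e : E → S, IsOpenEmbedding e ∧ p ∈ range e ∧ q ∈ range e
  have : Std.Symm P := ⟨fun p q ⟨e, he, hp, hq⟩ => ⟨e, he, hq, hp⟩⟩
  refine PreconnectedSpace.induction₂ P (fun x => ?_) ⟨fun x y z => ?_⟩ p q
  · obtain ⟨e, he, rfl, -⟩ := exists_isOpenEmbedding_range_subset (E := E) (univ_mem (f := 𝓝 x))
    filter_upwards [he.isOpen_range.mem_nhds (mem_range_self 0)] with y hy
    exact ⟨e, he, mem_range_self 0, hy⟩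
  · rintro ⟨e, he, hx, b, rfl⟩ ⟨d, hd, ⟨a, ha⟩, c, rfl⟩
    by_cases hxd : x ∈ range d
    · exact ⟨d, hd, hxd, mem_range_self c⟩
    · obtain ⟨h, hac, hfix⟩ := exists_homeomorph_apply_eq_of_mem_range hd a c
      refine ⟨h ∘ e, h.isOpenEmbedding.comp he, ?_, b, by rw [Function.comp_apply, ← ha, hac]⟩
      rw [range_comp]
      exact ⟨x, hx, hfix x hxd⟩

end EmbeddedSpaces

section Orientation

variable {X : Type*} [TopologicalSpace X] {c d e : OpenPartialHomeomorph X ℂ} {x y : X} {m n : ℤ}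

theorem transition_source_mem_nhds (hxc : x ∈ c.source) (hxd : x ∈ d.source) :
    (c.symm.trans d).source ∈ 𝓝 (c x) :=
  (c.symm.trans d).open_source.mem_nhds (by simp [hxc, hxd])

theorem exists_hasLocalDegree_transition (hxc : x ∈ c.source) (hxd : x ∈ d.source) :
    ∃ n, ∀ᶠ y in 𝓝 x, HasLocalDegree (fun z => d (c.symm z)) (c y) n :=
  (exists_eventually_hasLocalDegree (transition_source_mem_nhds hxc hxd)
    (c.symm.trans d).continuousOn (c.symm.trans d).injOn).imp
    fun _ hn => (c.continuousAt hxc).eventually hn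

theorem OrientationCompatible.hasLocalDegree (h : OrientationCompatible c d) (hxc : x ∈ c.source)
    (hxd : x ∈ d.source) : HasLocalDegree (fun z => d (c.symm z)) (c x) 1 :=
  (h x ⟨hxc, hxd⟩).hasLocalDegree (transition_source_mem_nhds hxc hxd)
    (c.symm.trans d).continuousOn (c.symm.trans d).injOn

theorem hasLocalDegree_transition_self (hxc : x ∈ c.source) :
    HasLocalDegree (fun z => c (c.symm z)) (c x) 1 := by
  refine (HasLocalDegree.id (c x)).congr ?_
  filter_upwards [c.open_target.mem_nhds (c.map_source hxc)] with z hz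
  exact (c.right_inv hz).symm

theorem HasLocalDegree.transition_trans (hxc : x ∈ c.source) (hxd : x ∈ d.source)
    (h : HasLocalDegree (fun z => d (c.symm z)) (c x) m)
    (h' : HasLocalDegree (fun z => e (d.symm z)) (d x) n) :
    HasLocalDegree (fun z => e (c.symm z)) (c x) (n * m) := by
  have hnhds := transition_source_mem_nhds hxc hxd
  refine HasLocalDegree.congr (HasLocalDegree.comp (h := fun z => e (d.symm z))
    (by rwa [c.left_inv hxc]) h ((c.symm.trans d).continuousOn.continuousAt hnhds)) ?_
  filter_upwards [hnhds] with z hz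
  rw [OpenPartialHomeomorph.trans_source] at hz
  exact congrArg e (d.left_inv hz.2)

namespace SurfaceOrientation

/-- The degree of a chart `c` at a point `x` with respect to the positively oriented charts, for
`c` that need not be compatible with the orientation. -/
def HasChartDegree (o : SurfaceOrientation X) (c : OpenPartialHomeomorph X ℂ) (x : X) (n : ℤ) :
    Prop :=
  ∀ d ∈ o.charts, x ∈ d.source → HasLocalDegree (fun z => d (c.symm z)) (c x) n

variable {o : SurfaceOrientation X}

theorem HasChartDegree.unique (hm : o.HasChartDegree c x m) (hn : o.HasChartDegree c x n) :
    m = n :=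
  have ⟨d, hd, hxd⟩ := o.covers x
  (hm d hd hxd).unique (hn d hd hxd)

theorem exists_eventually_hasChartDegree (o : SurfaceOrientation X) (hxc : x ∈ c.source) :
    ∃ n, ∀ᶠ y in 𝓝 x, o.HasChartDegree c y n := by
  obtain ⟨d, hd, hxd⟩ := o.covers x
  obtain ⟨n, hn⟩ := exists_hasLocalDegree_transition hxc hxd
  refine ⟨n, ?_⟩
  filter_upwards [hn, c.open_source.mem_nhds hxc, d.open_source.mem_nhds hxd]
    with y hy hyc hyd d' hd' hyd'
  simpa using hy.transition_trans hyc hyd ((o.compatible d hd d' hd').hasLocalDegree hyd hyd')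

theorem exists_hasChartDegree_of_isPreconnected (o : SurfaceOrientation X)
    (hc : IsPreconnected c.source) (hx : x ∈ c.source) (hy : y ∈ c.source) :
    ∃ n, o.HasChartDegree c x n ∧ o.HasChartDegree c y n := by
  refine hc.induction₂ (fun x y => ∃ n, o.HasChartDegree c x n ∧ o.HasChartDegree c y n)
    (fun x hx => ?_) ?_ ?_ hx hy
  · obtain ⟨n, hn⟩ := o.exists_eventually_hasChartDegree hx
    exact (hn.filter_mono inf_le_left).mono fun y hy => ⟨n, hn.self_of_nhds, hy⟩
  · rintro x y z - - - ⟨m, hxm, hym⟩ ⟨n, hyn, hzn⟩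
    exact ⟨n, hym.unique hyn ▸ hxm, hzn⟩
  · rintro x y - - ⟨n, hxn, hyn⟩
    exact ⟨n, hyn, hxn⟩

end SurfaceOrientation

-- The chart `c` may reverse the orientation, but it has the same degree at `x` and at `f x`, and
-- the two contributions cancel.
theorem hasLocalDegree_one_of_mem_homeoPlus {o : SurfaceOrientation X} {f : X ≃ₜ X}
    (hf : f ∈ homeoPlus o) (hc : IsPreconnected c.source) (hx : x ∈ c.source)
    (hfx : f x ∈ c.source) : HasLocalDegree (fun z => c (f (c.symm z))) (c x) 1 := by
  obtain ⟨n, hnx, hnfx⟩ := o.exists_hasChartDegree_of_isPreconnected hc hx hfx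
  obtain ⟨d, hd, hxd⟩ := o.covers (f x)
  obtain ⟨m, hm⟩ := exists_hasLocalDegree_transition hxd hfx
  have hmn : m * n = 1 := ((hnfx d hd hxd).transition_trans hfx hxd hm.self_of_nhds).unique
    (hasLocalDegree_transition_self hfx)
  have hdf : HasLocalDegree (fun z => d (f (c.symm z))) (c x) n :=
    hnx (f.transOpenPartialHomeomorph d) ((hf d).mpr hd) (by simpa using hxd)
  rw [← hmn]
  refine hdf.transition_trans (d := f.transOpenPartialHomeomorph d)
    (e := f.transOpenPartialHomeomorph c) hx (by simpa using hxd) ?_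
  simpa using hm.self_of_nhds

end Orientation

section Punctures

variable {E S : Type*} [NormedAddCommGroup E] [NormedSpace ℝ E] [TopologicalSpace S]
  {P : Finset S} {p q y : S}

theorem isPathConnected_preimage_val_range (hE : 1 < Module.rank ℝ E) {e : E → S}
    (he : Continuous e) (hi : Function.Injective e) (P : Finset S) :
    IsPathConnected (Subtype.val ⁻¹' range e : Set (Punctured S P)) := by
  have hcompl : IsPathConnected (e ⁻¹' P)ᶜ :=
    (P.finite_toSet.preimage hi.injOn).countable.isPathConnected_compl_of_one_lt_rank hE
  have hval : IsInducing (Subtype.val : Punctured S P → S) := .subtypeVal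
  rw [hval.isPathConnected_iff]
  convert hcompl.image he
  ext x
  constructor
  · rintro ⟨⟨_, hz⟩, ⟨z, rfl⟩, rfl⟩
    exact ⟨z, hz, rfl⟩
  · rintro ⟨z, hz, rfl⟩
    exact ⟨⟨e z, hz⟩, mem_range_self z, rfl⟩

theorem exists_isPathConnected_mem_punctureFilter (hE : 1 < Module.rank ℝ E) [ChartedSpace E S]
    {W : Set (Punctured S P)} (hW : W ∈ punctureFilter P y) :
    ∃ V ∈ punctureFilter P y, IsPathConnected V ∧ V ⊆ W := by
  obtain ⟨O, hO, hOW⟩ := mem_comap.mp hW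
  obtain ⟨e, he, rfl, heO⟩ := exists_isOpenEmbedding_range_subset (E := E) hO
  exact ⟨_, preimage_mem_comap (he.isOpen_range.mem_nhds (mem_range_self 0)),
    isPathConnected_preimage_val_range hE he.continuous he.injective P,
    (preimage_mono heO).trans hOW⟩

theorem punctureFilter_neBot (hE : 1 < Module.rank ℝ E) [ChartedSpace E S] (P : Finset S) (y : S) :
    (punctureFilter P y).NeBot := by
  refine forall_mem_nonempty_iff_neBot.mp fun W hW => ?_
  obtain ⟨V, -, hV, hVW⟩ := exists_isPathConnected_mem_punctureFilter hE hW
  exact hV.nonempty.mono hVW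

theorem preconnectedSpace_of_punctured (hE : 1 < Module.rank ℝ E) [ChartedSpace E S] (P : Finset S)
    [PreconnectedSpace (Punctured S P)] : PreconnectedSpace S :=
  DenseRange.preconnectedSpace (f := (Subtype.val : Punctured S P → S))
    (fun y => have := punctureFilter_neBot hE P y
      mem_closure_of_tendsto (b := punctureFilter P y) tendsto_comap
        (Eventually.of_forall mem_range_self)) continuous_subtype_val

theorem exists_tendsto_nhds_of_tendsto_nhdsSet {X Y : Type*} [TopologicalSpace X]
    [TopologicalSpace Y] [T2Space Y] {l : Filter X} [l.NeBot]
    (hl : ∀ W ∈ l, ∃ V ∈ l, IsPreconnected V ∧ V ⊆ W) {g : X → Y} (hg : Continuous g) {F : Set Y}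
    (hF : F.Finite) (h : Tendsto g l (𝓝ˢ F)) : ∃ q ∈ F, Tendsto g l (𝓝 q) := by
  obtain ⟨U, hU, hdisj⟩ := hF.t2_separation
  let others : Y → Set Y := fun q => ⋃ r ∈ F \ {q}, U r
  have hothers : ∀ q, IsOpen (others q) := fun q => isOpen_biUnion fun r _ => (hU r).2
  have hcover : ∀ q, ∀ W ∈ 𝓝 q, W ∪ others q ∈ 𝓝ˢ F := fun q W hW => by
    refine mem_nhdsSet_iff_forall.mpr fun r hr => ?_
    by_cases hrq : r = q
    · exact mem_of_superset (hrq ▸ hW) subset_union_left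
    · exact mem_of_superset ((hothers q).mem_nhds (mem_biUnion ⟨hr, hrq⟩ (hU r).1))
        subset_union_right
  have hunion : (⋃ r ∈ F, U r) ∈ 𝓝ˢ F :=
    (isOpen_biUnion fun r _ => (hU r).2).mem_nhdsSet.mpr fun r hr => mem_biUnion hr (hU r).1
  obtain ⟨V, hVl, hV, hVU⟩ := hl _ (h hunion)
  obtain ⟨v, hv⟩ := l.nonempty_of_mem hVl
  obtain ⟨q, hq, hvq⟩ := mem_iUnion₂.mp (hVU hv)
  have hdisj_others : Disjoint (U q) (others q) :=
    disjoint_iUnion₂_right.mpr fun r hr => hdisj hq hr.1 (Ne.symm hr.2)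
  have hVq : g '' V ⊆ U q := by
    refine (hV.image g hg.continuousOn).subset_left_of_subset_union (hU q).2 (hothers q)
      hdisj_others ?_ ⟨g v, mem_image_of_mem g hv, hvq⟩
    rintro _ ⟨w, hw, rfl⟩
    obtain ⟨r, hr, hwr⟩ := mem_iUnion₂.mp (hVU hw)
    by_cases hrq : r = q
    · exact Or.inl (hrq ▸ hwr)
    · exact Or.inr (mem_biUnion ⟨hr, hrq⟩ hwr)
  refine ⟨q, hq, fun W hW => mem_map.mpr ?_⟩
  filter_upwards [h (hcover q W hW), hVl] with w hw hwV
  exact hw.resolve_right (hdisj_others.notMem_of_mem_left (hVq (mem_image_of_mem g hwV)))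

theorem tendsto_val_cocompact_nhdsSet [CompactSpace S] (P : Finset S) :
    Tendsto (Subtype.val : Punctured S P → S) (cocompact _) (𝓝ˢ P) := by
  refine (hasBasis_nhdsSet _).tendsto_right_iff.mpr fun O hO => ?_
  have hK : IsCompact (Subtype.val ⁻¹' Oᶜ : Set (Punctured S P)) := by
    have hval : IsInducing (Subtype.val : Punctured S P → S) := .subtypeVal
    rw [hval.isCompact_preimage_iff]
    · exact hO.1.isClosed_compl.isCompact
    · exact fun x hx => ⟨⟨x, fun hxP => hx (hO.2 hxP)⟩, rfl⟩
  filter_upwards [hK.compl_mem_cocompact] with x hx using not_not.mp hx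

theorem exists_tendsto_punctureFilter [T2Space S] [CompactSpace S] [ChartedSpace E S]
    (hE : 1 < Module.rank ℝ E) (f : Punctured S P ≃ₜ Punctured S P) (hp : p ∈ P) :
    ∃ q ∈ P, Tendsto f (punctureFilter P p) (punctureFilter P q) := by
  have := punctureFilter_neBot hE P p
  have hcocompact : punctureFilter P p ≤ cocompact (Punctured S P) :=
    comap_nhds_le_cocompact continuous_subtype_val (by simpa using hp)
  obtain ⟨q, hq, hfq⟩ := exists_tendsto_nhds_of_tendsto_nhdsSet (l := punctureFilter P p)
    (fun W hW => (exists_isPathConnected_mem_punctureFilter hE hW).imp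
      fun V hV => ⟨hV.1, hV.2.1.isConnected.isPreconnected, hV.2.2⟩)
    (continuous_subtype_val.comp f.continuous) P.finite_toSet
    ((tendsto_val_cocompact_nhdsSet P).comp
      (f.isClosedEmbedding.tendsto_cocompact.mono_left hcocompact))
  exact ⟨q, hq, tendsto_comap_iff.mpr hfq⟩

theorem exists_map_punctureFilter_eq [T2Space S] [CompactSpace S] [ChartedSpace E S]
    (hE : 1 < Module.rank ℝ E) (f : Punctured S P ≃ₜ Punctured S P) (hp : p ∈ P) :
    ∃ q ∈ P, map f (punctureFilter P p) = punctureFilter P q := by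
  obtain ⟨q, hq, hfq⟩ := exists_tendsto_punctureFilter hE f hp
  obtain ⟨r, -, hfr⟩ := exists_tendsto_punctureFilter hE f.symm hq
  have := punctureFilter_neBot hE P p
  have hpr : Tendsto (fun x : Punctured S P => (x : S)) (punctureFilter P p) (𝓝 r) := by
    simpa [Function.comp_def] using tendsto_comap_iff.mp (hfr.comp hfq)
  obtain rfl := tendsto_nhds_unique (l := punctureFilter P p) tendsto_comap hpr
  refine ⟨q, hq, le_antisymm hfq ?_⟩
  simpa [map_map, Function.comp_def] using map_mono (m := f) hfr

end Punctures

section Winding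

variable {X : Type*} [TopologicalSpace X]

theorem monodromy_exp_sub_eq {z w : {z : ℂ // z ≠ 0}} (γ : Path.Homotopic.Quotient z w)
    (e e' : (fun ζ : ℂ => (⟨_, ζ.exp_ne_zero⟩ : {z : ℂ // z ≠ 0})) ⁻¹' {z}) :
    (Complex.isCoveringMap_exp.monodromy γ e : ℂ) - e =
      Complex.isCoveringMap_exp.monodromy γ e' - e' := by
  obtain ⟨γ⟩ := γ
  have hlift : ∀ e : (fun ζ : ℂ => (⟨_, ζ.exp_ne_zero⟩ : {z : ℂ // z ≠ 0})) ⁻¹' {z}, ∀ t,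
      Complex.exp (Complex.isCoveringMap_exp.liftPath γ e (γ.source.trans e.2.symm) t) = γ t :=
    fun e t => congrArg Subtype.val
      (congrFun (Complex.isCoveringMap_exp.liftPath_lifts γ e (γ.source.trans e.2.symm)) t)
  have hsub := sub_eq_sub_of_exp_eq (isPreconnected_univ (α := I))
    (ContinuousMap.continuous _).continuousOn (ContinuousMap.continuous _).continuousOn
    (fun t _ => (hlift e t).trans (hlift e' t).symm) (mem_univ 0) (mem_univ 1)
  rwa [Complex.isCoveringMap_exp.liftPath_zero, Complex.isCoveringMap_exp.liftPath_zero] at hsub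

/-- The increment of a continuous logarithm of `u` along a homotopy class of paths. -/
def logIncrement (u : C(X, {z : ℂ // z ≠ 0})) {x y : FundamentalGroupoid X} (γ : x ⟶ y) : ℂ :=
  Complex.isCoveringMap_exp.monodromy ((FundamentalGroupoid.map u).map γ)
    ⟨Complex.log (u x.as), Subtype.ext (Complex.exp_log (u x.as).2)⟩ - Complex.log (u x.as)

variable (u : C(X, {z : ℂ // z ≠ 0})) {x y z : FundamentalGroupoid X}

theorem logIncrement_comp (γ : x ⟶ y) (δ : y ⟶ z) :
    logIncrement u (γ ≫ δ) = logIncrement u γ + logIncrement u δ := by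
  let e : (fun ζ : ℂ => (⟨_, ζ.exp_ne_zero⟩ : {z : ℂ // z ≠ 0})) ⁻¹' {u x.as} :=
    ⟨Complex.log (u x.as), Subtype.ext (Complex.exp_log (u x.as).2)⟩
  have hδ : logIncrement u δ = _ := monodromy_exp_sub_eq ((FundamentalGroupoid.map u).map δ) _
    (Complex.isCoveringMap_exp.monodromy ((FundamentalGroupoid.map u).map γ) e)
  have hcomp := Complex.isCoveringMap_exp.monodromy_trans_apply
    ((FundamentalGroupoid.map u).map γ) ((FundamentalGroupoid.map u).map δ) e
  rw [hδ, ← hcomp, logIncrement, Functor.map_comp, logIncrement]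
  exact (sub_add_sub_cancel' _ _ _).symm

theorem logIncrement_conj (γ : x ⟶ y) (β : y ⟶ y) :
    logIncrement u (γ ≫ β ≫ Groupoid.inv γ) = logIncrement u β := by
  have h := logIncrement_comp u (γ ≫ β ≫ Groupoid.inv γ) γ
  rw [Category.assoc, Category.assoc, Groupoid.inv_comp, Category.comp_id, logIncrement_comp] at h
  linear_combination -h

theorem logIncrement_fromPath {x y : X} (γ : Path x y) {L : I → ℂ} (hL : Continuous L)
    (h : ∀ t, Complex.exp (L t) = u (γ t)) :
    logIncrement u (FundamentalGroupoid.fromPath (.mk γ)) = L 1 - L 0 := by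
  have h0 : (⟨_, (L 0).exp_ne_zero⟩ : {z : ℂ // z ≠ 0}) = u x :=
    Subtype.ext ((h 0).trans (congrArg (fun y => (u y : ℂ)) γ.source))
  refine (monodromy_exp_sub_eq _ _ ⟨L 0, h0⟩).trans (congrArg (· - L 0) ?_)
  exact (congrFun ((Complex.isCoveringMap_exp.eq_liftPath_iff (γ_0 :=
    (γ.map u.continuous).source.trans h0.symm)).mpr
      ⟨hL, funext fun t => Subtype.ext (h t), rfl⟩) 1).symm

theorem exists_int_logIncrement_eq (γ : x ⟶ x) :
    ∃ n : ℤ, logIncrement u γ = n * (2 * Real.pi * Complex.I) := by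
  let e : (fun ζ : ℂ => (⟨_, ζ.exp_ne_zero⟩ : {z : ℂ // z ≠ 0})) ⁻¹' {u x.as} :=
    ⟨Complex.log (u x.as), Subtype.ext (Complex.exp_log (u x.as).2)⟩
  have he := (Complex.isCoveringMap_exp.monodromy ((FundamentalGroupoid.map u).map γ) e).2
  obtain ⟨n, hn⟩ := Complex.exp_eq_exp_iff_exists_int.mp
    (congrArg Subtype.val (he.trans e.2.symm))
  exact ⟨n, sub_eq_of_eq_add' hn⟩

/-- The homomorphism `π₁(X, x₀) → ℤ` which counts how often the image under `u` of a loop winds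
around the origin. -/
def windingHom (x₀ : X) : FundamentalGroup X x₀ →* Multiplicative ℤ :=
  MonoidHom.mk' (fun γ => .ofAdd (exists_int_logIncrement_eq u γ).choose) fun γ δ => by
    rw [← ofAdd_add]
    refine congrArg _ (Int.cast_injective (mul_right_cancel₀ Complex.two_pi_I_ne_zero ?_))
    rw [← (exists_int_logIncrement_eq u (γ * δ)).choose_spec, Int.cast_add, add_mul,
      ← (exists_int_logIncrement_eq u γ).choose_spec,
      ← (exists_int_logIncrement_eq u δ).choose_spec, End.mul_def, logIncrement_comp, add_comm]

theorem windingHom_eq_ofAdd {x₀ : X} {γ : FundamentalGroup X x₀} {n : ℤ}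
    (h : logIncrement u γ = n * (2 * Real.pi * Complex.I)) : windingHom u x₀ γ = .ofAdd n := by
  refine congrArg Multiplicative.ofAdd
    (Int.cast_injective (mul_right_cancel₀ Complex.two_pi_I_ne_zero ?_))
  rw [← (exists_int_logIncrement_eq u γ).choose_spec, h]

end Winding

section LocalDegreeAtPuncture

theorem HasLocalDegree.exists_log_div {g : ℂ → ℂ} {z c : ℂ} {n : ℤ} (hn : HasLocalDegree g z n)
    (hg : ContinuousAt g z) (hc : g z ≠ c) :
    ∃ (a : ℝ) (Φ : ℂ → ℂ), ContinuousOn Φ {ζ | ζ.re < a} ∧ ∀ ζ : ℂ, ζ.re < a →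
      Complex.exp (Φ ζ) = (g (z + Complex.exp ζ) - g z) / (g (z + Complex.exp ζ) - c) ∧
      Φ (ζ + 2 * Real.pi * Complex.I) = Φ ζ + n * (2 * Real.pi * Complex.I) := by
  obtain ⟨a, Φ, hΦ, hΦg⟩ := hn
  have hc' : g z - c ≠ 0 := sub_ne_zero.mpr hc
  have hquot : Tendsto (fun ζ => (g (z + Complex.exp ζ) - c) / (g z - c)) (comap Complex.re atBot)
      (𝓝 1) := by
    simpa [hc'] using
      ((hg.tendsto.comp (tendsto_add_exp_comap_re_atBot z)).sub_const c).div_const (g z - c)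
  obtain ⟨b, hb⟩ := eventually_comap_re_atBot_iff.mp
    (hquot.eventually_mem (Complex.isOpen_slitPlane.mem_nhds Complex.one_mem_slitPlane))
  have hgΦ : ∀ ζ : ℂ, ζ.re < a → g (z + Complex.exp ζ) = g z + Complex.exp (Φ ζ) := fun ζ hζ => by
    rw [(hΦg ζ hζ).1, add_sub_cancel]
  have hg' : ContinuousOn (fun ζ => g (z + Complex.exp ζ)) {ζ : ℂ | ζ.re < a} :=
    (continuousOn_const.add hΦ.cexp).congr hgΦ
  have hleft : {ζ : ℂ | ζ.re < min a b} ⊆ {ζ | ζ.re < a} :=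
    fun ζ hζ => lt_of_lt_of_le hζ (min_le_left a b)
  refine ⟨min a b, fun ζ => Φ ζ - (Complex.log ((g (z + Complex.exp ζ) - c) / (g z - c)) +
    Complex.log (g z - c)), ?_, fun ζ hζ => ⟨?_, ?_⟩⟩
  · refine (hΦ.mono hleft).sub (ContinuousOn.add (ContinuousOn.clog ?_ fun ζ hζ => ?_)
      continuousOn_const)
    · exact ((hg'.mono hleft).sub continuousOn_const).div_const _
    · exact hb ζ (lt_of_lt_of_le hζ (min_le_right a b))
  · have hslit := hb ζ (lt_of_lt_of_le hζ (min_le_right a b))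
    rw [Complex.exp_sub, Complex.exp_add, Complex.exp_log (Complex.slitPlane_ne_zero hslit),
      Complex.exp_log hc', div_mul_cancel₀ _ hc', (hΦg ζ (hleft hζ)).1]
  · dsimp only
    rw [(hΦg ζ (hleft hζ)).2, Complex.exp_periodic ζ, sub_add_eq_add_sub]

theorem hasLocalDegree_update {k : OpenPartialHomeomorph ℂ ℂ} {a b : ℂ} {n : ℤ}
    (ha : a ∉ k.source) (hsource : k.source ∈ 𝓝[≠] a) (hb : b ∉ k.target)
    (hk : Tendsto k (𝓝[≠] a) (𝓝 b)) (hn : ∀ z ∈ k.source, HasLocalDegree k z n) :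
    HasLocalDegree (Function.update k a b) a n := by
  have heq : EqOn (Function.update k a b) k k.source := fun z hz =>
    Function.update_of_ne (ne_of_mem_of_not_mem hz ha) b k
  refine hasLocalDegree_of_frequently (U := insert a k.source) ?_ ?_ ?_ ?_
  · exact insert_mem_nhds_iff.mpr hsource
  · rintro z (rfl | hz)
    · exact (continuousAt_update_same.mpr hk).continuousWithinAt
    · exact ((continuousAt_update_of_ne (ne_of_mem_of_not_mem hz ha)).mpr
        (k.continuousAt hz)).continuousWithinAt
  · rw [injOn_insert ha, heq.injOn_iff, heq.image_eq, Function.update_self]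
    exact ⟨k.injOn, k.image_source_eq_target ▸ hb⟩
  · have hevent : ∀ᶠ z in 𝓝[≠] a, HasLocalDegree (Function.update k a b) z n := by
      filter_upwards [hsource] with z hz
      exact (hn z hz).congr (heq.symm.eventuallyEq_of_mem (k.open_source.mem_nhds hz))
    exact hevent.frequently.filter_mono nhdsWithin_le_nhds

end LocalDegreeAtPuncture

section PuncturedChart

variable {S : Type*} [TopologicalSpace S] [T1Space S] {e : ℂ → S} (he : IsOpenEmbedding e)
  (P : Finset S) [Nonempty (Punctured S P)]

/-- The inverse of an open embedding `e` of the plane, as a chart of the punctured surface. -/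
def puncturedChart : OpenPartialHomeomorph (Punctured S P) ℂ :=
  (P.finite_toSet.isClosed.isOpen_compl.isOpenEmbedding_subtypeVal.toOpenPartialHomeomorph
    (Subtype.val : Punctured S P → S)).trans (he.toOpenPartialHomeomorph e).symm

theorem puncturedChart_source : (puncturedChart he P).source = Subtype.val ⁻¹' range e := by
  simp [puncturedChart]

theorem puncturedChart_target : (puncturedChart he P).target = {z | e z ∉ P} := by
  ext z
  simp [puncturedChart]

variable {P}

theorem apply_puncturedChart {x : Punctured S P} (hx : (x : S) ∈ range e) :
    e (puncturedChart he P x) = x :=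
  (he.toOpenPartialHomeomorph e).right_inv (by simpa using hx)

theorem coe_puncturedChart_symm {z : ℂ} (hz : e z ∉ P) :
    ((puncturedChart he P).symm z : S) = e z := by
  have hz' : z ∈ (puncturedChart he P).target := by rwa [puncturedChart_target]
  have hsource := (puncturedChart he P).map_target hz'
  rw [puncturedChart_source] at hsource
  rw [← apply_puncturedChart he hsource, (puncturedChart he P).right_inv hz']

theorem tendsto_puncturedChart (b : ℂ) :
    Tendsto (puncturedChart he P) (punctureFilter P (e b)) (𝓝 b) := by
  rw [he.isInducing.nhds_eq_comap, tendsto_comap_iff]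
  refine tendsto_comap.congr' ?_
  filter_upwards [preimage_mem_comap (he.isOpen_range.mem_nhds (mem_range_self b))] with x hx
  exact (apply_puncturedChart he hx).symm

theorem puncturedChart_target_mem_nhdsNE (P : Finset S) [Nonempty (Punctured S P)] (a : ℂ) :
    (puncturedChart he P).target ∈ 𝓝[≠] a := by
  rw [puncturedChart_target]
  exact mem_of_superset (nhdsNE_of_nhdsNE_sdiff_finite univ_mem
    (P.finite_toSet.preimage he.injective.injOn)) fun z hz => hz.2

theorem tendsto_puncturedChart_symm (a : ℂ) :
    Tendsto (puncturedChart he P).symm (𝓝[≠] a) (punctureFilter P (e a)) := by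
  refine tendsto_comap_iff.mpr ((he.continuous.tendsto a |>.mono_left nhdsWithin_le_nhds).congr' ?_)
  filter_upwards [puncturedChart_target_mem_nhdsNE he P a] with z hz
  exact (coe_puncturedChart_symm he (by rwa [puncturedChart_target] at hz)).symm

end PuncturedChart

section PunctureQuotient

theorem tendsto_sub_div_sub_cocompact (a b : ℂ) :
    Tendsto (fun z => (z - a) / (z - b)) (cocompact ℂ) (𝓝 1) := by
  have hinv : Tendsto (fun z : ℂ => 1 + (b - a) * (z - b)⁻¹) (cocompact ℂ) (𝓝 1) := by
    have hsub : Tendsto (fun z : ℂ => z - b) (cocompact ℂ) (cocompact ℂ) :=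
      (Homeomorph.subRight b).isClosedEmbedding.tendsto_cocompact
    rw [← Metric.cobounded_eq_cocompact] at hsub ⊢
    simpa using ((tendsto_inv₀_cobounded.comp hsub).const_mul (b - a)).const_add 1
  refine hinv.congr' ?_
  filter_upwards [isCompact_singleton.compl_mem_cocompact] with z (hz : z ≠ b)
  have := sub_ne_zero.mpr hz
  field_simp
  ring

variable {S : Type*} [TopologicalSpace S] [T2Space S] {e : ℂ → S} (he : IsOpenEmbedding e)
  {P : Finset S} {a b : ℂ}

/-- The function `(z - a) / (z - b)` in the coordinate given by an open embedding of the plane,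
extended by `1` to the rest of the surface. It has degree `1` about the puncture `e a` and degree
`-1` about the puncture `e b`. -/
def punctureQuotient (ha : e a ∈ P) (hb : e b ∈ P) : C(Punctured S P, {z : ℂ // z ≠ 0}) where
  toFun x := ⟨Function.extend e (fun z => (z - a) / (z - b)) 1 x, by
    by_cases hx : (x : S) ∈ range e
    · obtain ⟨z, hz⟩ := hx
      rw [← hz, he.injective.extend_apply]
      refine div_ne_zero (sub_ne_zero.mpr ?_) (sub_ne_zero.mpr ?_) <;> rintro rfl
      · exact x.2 (hz ▸ ha)
      · exact x.2 (hz ▸ hb)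
    · rw [Function.extend_apply' _ _ _ hx]
      exact one_ne_zero⟩
  continuous_toFun := by
    refine Continuous.subtype_mk (continuous_iff_continuousAt.mpr fun x => ?_) _
    refine ContinuousAt.comp (g := Function.extend e (fun z => (z - a) / (z - b)) 1) ?_
      continuous_subtype_val.continuousAt
    by_cases hx : (x : S) ∈ range e
    · obtain ⟨z, hz⟩ := hx
      have hzb : z ≠ b := fun h => x.2 (hz ▸ h ▸ hb)
      rw [← hz]
      exact continuousAt_extend_apply he (by fun_prop (disch := exact sub_ne_zero.mpr hzb))
    · exact continuousAt_extend_of_notMem_range he.injective hx continuousAt_const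
        ((tendsto_sub_div_sub_cocompact a b).mono_left (comap_nhds_le_cocompact he.continuous hx))

theorem punctureQuotient_apply (ha : e a ∈ P) (hb : e b ∈ P) {x : Punctured S P} {z : ℂ}
    (hz : e z = x) : (punctureQuotient he ha hb x : ℂ) = (z - a) / (z - b) := by
  rw [← he.injective.extend_apply (fun z => (z - a) / (z - b)) 1 z, hz]
  rfl

end PunctureQuotient

section PunctureLoop

theorem logIncrement_fromPath_of_periodic {X : Type*} [TopologicalSpace X]
    {u : C(X, {z : ℂ // z ≠ 0})} {Φ : ℂ → ℂ} {a s : ℝ} {n : ℤ}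
    (hΦ : ContinuousOn Φ {ζ | ζ.re < a}) (hs : s < a)
    (hn : Φ (s + 2 * Real.pi * Complex.I) = Φ s + n * (2 * Real.pi * Complex.I))
    {x : X} (γ : Path x x)
    (h : ∀ t : I, Complex.exp (Φ (s + (t : ℝ) * (2 * Real.pi * Complex.I))) = u (γ t)) :
    logIncrement u (FundamentalGroupoid.fromPath (.mk γ)) = n * (2 * Real.pi * Complex.I) := by
  rw [logIncrement_fromPath u γ (hΦ.comp_continuous (by fun_prop) fun t => by simpa using hs) h]
  simp [hn]

variable {S : Type*} [TopologicalSpace S] [T2Space S] {e : ℂ → S} {P : Finset S}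
  [Nonempty (Punctured S P)] {o : SurfaceOrientation (Punctured S P)}
  {f : Punctured S P ≃ₜ Punctured S P} {a b : ℂ}

theorem hasLocalDegree_update_puncturedChart (he : IsOpenEmbedding e) (ha : e a ∈ P) (hb : e b ∈ P)
    (hf : f ∈ homeoPlus o)
    (hfab : Tendsto f (punctureFilter P (e a)) (punctureFilter P (e b))) :
    let c := puncturedChart he P
    (∀ᶠ z in 𝓝[≠] a, z ∈ c.target ∧ f (c.symm z) ∈ c.source) ∧
      ContinuousAt (Function.update (fun z => c (f (c.symm z))) a b) a ∧
      HasLocalDegree (Function.update (fun z => c (f (c.symm z))) a b) a 1 := by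
  intro c
  have hP : ∀ {z}, e z ∈ P → z ∉ c.target := fun hz => by
    simpa [c, puncturedChart_target] using hz
  have hc : IsPreconnected c.source := by
    rw [puncturedChart_source]
    exact (isPathConnected_preimage_val_range (Complex.rank_real_complex ▸ Nat.one_lt_ofNat)
      he.continuous he.injective P).isConnected.isPreconnected
  let k := c.symm.trans (f.transOpenPartialHomeomorph c)
  have hsource : k.source ∈ 𝓝[≠] a := by
    refine inter_mem (puncturedChart_target_mem_nhdsNE he P a)
      ((hfab.comp (tendsto_puncturedChart_symm he a)).eventually_mem (s := c.source) ?_)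
    rw [puncturedChart_source]
    exact preimage_mem_comap (he.isOpen_range.mem_nhds (mem_range_self b))
  have hk : Tendsto k (𝓝[≠] a) (𝓝 b) :=
    (tendsto_puncturedChart he b).comp (hfab.comp (tendsto_puncturedChart_symm he a))
  refine ⟨hsource, continuousAt_update_same.mpr hk,
    hasLocalDegree_update (k := k) (fun h => hP ha h.1) hsource (fun h => hP hb h.1) hk ?_⟩
  intro z hz
  have := hasLocalDegree_one_of_mem_homeoPlus hf hc (c.map_target hz.1) hz.2
  rwa [c.right_inv hz.1] at this

theorem exists_logIncrement_punctureQuotient (hf : f ∈ homeoPlus o) (he : IsOpenEmbedding e)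
    (ha : e a ∈ P) (hb : e b ∈ P) (hab : a ≠ b)
    (hfab : Tendsto f (punctureFilter P (e a)) (punctureFilter P (e b))) :
    ∃ (y : Punctured S P) (β : Path y y),
      logIncrement (punctureQuotient he ha hb) (FundamentalGroupoid.fromPath (.mk β)) =
        (1 : ℤ) * (2 * Real.pi * Complex.I) ∧
      logIncrement (punctureQuotient he ha hb)
        (FundamentalGroupoid.fromPath (.mk (β.map f.continuous))) =
          (-1 : ℤ) * (2 * Real.pi * Complex.I) := by
  let c := puncturedChart he P
  obtain ⟨hdomain, hcont, hdegree⟩ := hasLocalDegree_update_puncturedChart he ha hb hf hfab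
  obtain ⟨r, hr⟩ := eventually_comap_re_atBot_iff.mp
    ((tendsto_add_exp_comap_re_atBot a).eventually (eventually_nhdsWithin_iff.mp hdomain))
  obtain ⟨r₁, Φ, hΦ, hΦa⟩ := (HasLocalDegree.id a).exists_log_div continuousAt_id hab
  obtain ⟨r₂, Ψ, hΨ, hΨa⟩ := hdegree.exists_log_div hcont (c := a)
    (by rw [Function.update_self]; exact hab.symm)
  obtain ⟨s, hs⟩ := exists_lt (min r (min r₁ r₂))
  obtain ⟨hsr, hs₁, hs₂⟩ : s < r ∧ s < r₁ ∧ s < r₂ := by simpa only [lt_min_iff] using hs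
  let ℓ : I → ℂ := fun t => s + (t : ℝ) * (2 * Real.pi * Complex.I)
  have hre : ∀ t, (ℓ t).re = s := fun t => by simp [ℓ]
  have hne : ∀ t, a + Complex.exp (ℓ t) ≠ a := fun t => by simp
  have hmem : ∀ t, a + Complex.exp (ℓ t) ∈ c.target ∧
      f (c.symm (a + Complex.exp (ℓ t))) ∈ c.source := fun t => hr _ (hre t ▸ hsr) (hne t)
  let β : Path (c.symm (a + Complex.exp s)) (c.symm (a + Complex.exp s)) :=
    { toFun := fun t => c.symm (a + Complex.exp (ℓ t))
      continuous_toFun := c.continuousOn_symm.comp_continuous (by fun_prop) fun t => (hmem t).1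
      source' := by simp [ℓ]
      target' := by simp [ℓ, Complex.exp_periodic (s : ℂ)] }
  refine ⟨_, β, logIncrement_fromPath_of_periodic hΦ hs₁ (hΦa s hs₁).2 β fun t => ?_,
    logIncrement_fromPath_of_periodic hΨ.neg hs₂ ?_ (β.map f.continuous) fun t => ?_⟩
  · have hz : e (a + Complex.exp (ℓ t)) = β t :=
      (coe_puncturedChart_symm he (by simpa [puncturedChart_target, c] using (hmem t).1)).symm
    rw [punctureQuotient_apply he ha hb hz, (hΦa (ℓ t) (hre t ▸ hs₁)).1]
  · simp only [Pi.neg_apply, (hΨa s hs₂).2, Int.cast_neg, Int.cast_one]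
    ring
  · have hz : e (c (f (β t))) = f (β t) :=
      apply_puncturedChart he ((puncturedChart_source he P).subset (hmem t).2)
    rw [Pi.neg_apply, Complex.exp_neg, (hΨa (ℓ t) (hre t ▸ hs₂)).1, inv_div,
      Function.update_self, Function.update_of_ne (hne t)]
    exact (punctureQuotient_apply he ha hb hz).symm

end PunctureLoop

section Detection

variable {X : Type*} [TopologicalSpace X]

theorem exists_windingHom_eq_of_logIncrement [PathConnectedSpace X] (u : C(X, {z : ℂ // z ≠ 0}))
    (f : X ≃ₜ X) {x₀ : X} (γ : FundamentalGroupoid.mk x₀ ⟶ FundamentalGroupoid.mk (f x₀)) {y : X}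
    (β : Path y y) {m n : ℤ}
    (hm : logIncrement u (FundamentalGroupoid.fromPath (.mk β)) = m * (2 * Real.pi * Complex.I))
    (hn : logIncrement u (FundamentalGroupoid.fromPath (.mk (β.map f.continuous))) =
      n * (2 * Real.pi * Complex.I)) :
    ∃ α : FundamentalGroup X x₀,
      windingHom u x₀ α = .ofAdd m ∧ windingHom u x₀ (pushAut f γ α) = .ofAdd n := by
  let F := FundamentalGroupoid.map (f : C(X, X))
  let δ := FundamentalGroupoid.fromPath (.mk (PathConnectedSpace.somePath x₀ y))
  let b := FundamentalGroupoid.fromPath (.mk β)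
  refine ⟨δ ≫ b ≫ Groupoid.inv δ, windingHom_eq_ofAdd u ?_, windingHom_eq_ofAdd u ?_⟩
  · rwa [logIncrement_conj]
  · have hpush : pushAut f γ (δ ≫ b ≫ Groupoid.inv δ) =
        (γ ≫ F.map δ) ≫ F.map b ≫ Groupoid.inv (γ ≫ F.map δ) :=
      (groupoid_conj_comp F γ δ b).symm
    rw [hpush, logIncrement_conj]
    exact hn

end Detection

section Characteristic

/-- The intersection of the kernels of all homomorphisms from `G` to `A`; it is a characteristic
subgroup of `G`, of finite index if `G` is finitely generated and `A` is finite. -/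
def commonKernel (G A : Type*) [Group G] [Group A] : Subgroup G :=
  ⨅ φ : G →* A, φ.ker

theorem mem_commonKernel {G A : Type*} [Group G] [Group A] {g : G} :
    g ∈ commonKernel G A ↔ ∀ φ : G →* A, φ g = 1 := by
  simp only [commonKernel, Subgroup.mem_iInf, MonoidHom.mem_ker]

theorem commonKernel_characteristic (G A : Type*) [Group G] [Group A] :
    (commonKernel G A).Characteristic :=
  Subgroup.characteristic_iff_le_comap.mpr fun ψ _ hg =>
    mem_commonKernel.mpr fun φ => mem_commonKernel.mp hg (φ.comp ψ.toMonoidHom)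

theorem finite_monoidHom_of_fg (G A : Type*) [Group G] [Group A] [Finite A] [hG : Group.FG G] :
    Finite (G →* A) := by
  obtain ⟨s, hs⟩ := hG.out
  exact Finite.of_injective (fun (φ : G →* A) (x : s) => φ x) fun _ _ h =>
    MonoidHom.eq_of_eqOn_dense hs fun x hx => congrFun h ⟨x, hx⟩

theorem commonKernel_finiteIndex (G A : Type*) [Group G] [Group A] [Finite A] [Group.FG G] :
    (commonKernel G A).FiniteIndex := by
  have := finite_monoidHom_of_fg G A
  exact Subgroup.finiteIndex_iInf fun φ => inferInstance

theorem map_eq_of_outQuotient_eq_one {G A : Type*} [Group G] [CommGroup A] {K : Subgroup G}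
    [K.Characteristic] (hK : K ≤ commonKernel G A) {ψ : MulAut G}
    (h : outQuotient K (QuotientGroup.mk ψ) = 1) (φ : G →* A) (α : G) : φ (ψ α) = φ α := by
  obtain ⟨g, hg⟩ := (QuotientGroup.eq_one_iff (autQuotient K ψ)).mp h
  obtain ⟨g, rfl⟩ := QuotientGroup.mk_surjective g
  have hconj : ((g * α * g⁻¹ : G) : G ⧸ K) = (ψ α : G) := DFunLike.congr_fun hg (α : G ⧸ K)
  have hφ := mem_commonKernel.mp (hK (QuotientGroup.eq.mp hconj)) φ
  rw [map_mul, map_inv, inv_mul_eq_one] at hφ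
  rw [← hφ, map_mul, map_mul, map_inv, mul_right_comm, mul_inv_cancel, one_mul]

end Characteristic

section GroupoidGeneration

variable {C : Type*} [Groupoid C] {x₀ : C}

-- `End x` multiplies in the order opposite to the vertex group, so the isomorphism is inversion.
theorem fg_end_iff_fg_vertexGroup {x : C} : Group.FG (End x) ↔ Group.FG (x ⟶ x) := by
  let e : End x ≃* (x ⟶ x) :=
    { toFun := fun g => Groupoid.inv g
      invFun := fun g => Groupoid.inv g
      left_inv := fun g => by simp
      right_inv := fun g => by simp
      map_mul' := fun g h => by simp [End.mul_def] }
  exact ⟨fun _ => Group.fg_of_surjective (f := e.toMonoidHom) e.surjective,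
    fun _ => Group.fg_of_surjective (f := e.symm.toMonoidHom) e.symm.surjective⟩

/-- The subgroupoid of the arrows which lie in the subgroup `H` of the vertex group at `x₀` once
their end points are joined to `x₀` by `ρ`. -/
def conjSubgroupoid (H : Subgroup (x₀ ⟶ x₀)) (ρ : ∀ a, x₀ ⟶ a) : Subgroupoid C where
  arrows a b := {γ | ρ a ≫ γ ≫ Groupoid.inv (ρ b) ∈ H}
  inv hγ := by simpa using H.inv_mem hγ
  mul hγ δ hδ := by simpa using H.mul_mem hγ hδ

variable {ι : Type*} (N : ι → Subgroupoid C) (U : ι → Set C) (x : ι → C)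

-- Once every object is joined to `x₀` through a piece containing it, the arrows of each piece
-- lie in `conjSubgroupoid H ρ`, which is therefore everything.
theorem vertexSubgroup_eq_top (τ : ∀ i, x₀ ⟶ x i) (hU : ∀ a, ∃ i, a ∈ U i)
    (hx : ∀ i, ∀ a ∈ U i, ((N i).arrows (x i) a).Nonempty)
    (hgen : ∀ M : Subgroupoid C,
      (∀ i, ∀ a ∈ U i, ∀ b ∈ U i, (N i).arrows a b ⊆ M.arrows a b) → M = ⊤)
    (H : Subgroup (x₀ ⟶ x₀))
    (hloop : ∀ i, ∀ g ∈ (N i).arrows (x i) (x i), τ i ≫ g ≫ Groupoid.inv (τ i) ∈ H)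
    (hswitch : ∀ i j, ∀ a ∈ U i ∩ U j, ∃ α ∈ (N i).arrows (x i) a, ∃ β ∈ (N j).arrows (x j) a,
      τ i ≫ (α ≫ Groupoid.inv β) ≫ Groupoid.inv (τ j) ∈ H) :
    H = ⊤ := by
  choose idx hidx using hU
  choose κ hκ using fun a => hx (idx a) a (hidx a)
  let ρ a : x₀ ⟶ a := τ (idx a) ≫ κ a
  have hρ : ∀ i, ∀ a ∈ U i, ∀ α ∈ (N i).arrows (x i) a, τ i ≫ α ≫ Groupoid.inv (ρ a) ∈ H := by
    intro i a ha α hα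
    obtain ⟨β, hβ, β', hβ', hββ'⟩ := hswitch i (idx a) a ⟨ha, hidx a⟩
    simpa [ρ] using H.mul_mem (hloop i _ ((N i).mul hα ((N i).inv hβ)))
      (H.mul_mem hββ' (hloop _ _ ((N _).mul hβ' ((N _).inv (hκ a)))))
  have htop : conjSubgroupoid H ρ = ⊤ := by
    refine hgen _ fun i a ha b hb γ hγ => ?_
    obtain ⟨α, hα⟩ := hx i a ha
    simpa [conjSubgroupoid] using
      H.mul_mem (H.inv_mem (hρ i a ha α hα)) (hρ i b hb _ ((N i).mul hα hγ))
  refine eq_top_iff.mpr fun g _ => ?_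
  have hg : Groupoid.inv (ρ x₀) ≫ g ≫ ρ x₀ ∈ (conjSubgroupoid H ρ).arrows x₀ x₀ :=
    htop ▸ Subgroupoid.mem_top _
  simpa [conjSubgroupoid] using hg

theorem fg_vertexGroup_of_subgroupoids [Finite ι] (hτ : ∀ i, Nonempty (x₀ ⟶ x i))
    (hU : ∀ a, ∃ i, a ∈ U i) (hx : ∀ i, ∀ a ∈ U i, ((N i).arrows (x i) a).Nonempty)
    (hgen : ∀ M : Subgroupoid C,
      (∀ i, ∀ a ∈ U i, ∀ b ∈ U i, (N i).arrows a b ⊆ M.arrows a b) → M = ⊤)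
    (K : ∀ i, Subgroup (x i ⟶ x i)) (hK : ∀ i, (K i).FG)
    (hNK : ∀ i, (N i).arrows (x i) (x i) ⊆ K i)
    (T : ∀ i j, Set (x i ⟶ x j)) (hT : ∀ i j, (T i j).Finite)
    (hNT : ∀ i j, ∀ a ∈ U i ∩ U j, ∃ α ∈ (N i).arrows (x i) a, ∃ β ∈ (N j).arrows (x j) a,
      α ≫ Groupoid.inv β ∈ T i j) :
    Group.FG (x₀ ⟶ x₀) := by
  have τ i : x₀ ⟶ x i := (hτ i).some
  choose s hs hs_fin using fun i => (Subgroup.fg_iff (K i)).mp (hK i)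
  let B : Set (x₀ ⟶ x₀) := (⋃ i, Groupoid.vertexGroupIsomOfMap (Groupoid.inv (τ i)) '' s i) ∪
    ⋃ p : ι × ι, (fun t => τ p.1 ≫ t ≫ Groupoid.inv (τ p.2)) '' T p.1 p.2
  have hB : B.Finite := (finite_iUnion fun i => (hs_fin i).image _).union
    (finite_iUnion fun p => (hT p.1 p.2).image _)
  refine Group.fg_iff.mpr ⟨B, vertexSubgroup_eq_top N U x τ hU hx hgen _ (fun i g hg => ?_)
    fun i j a ha => ?_, hB⟩
  · have hle : K i ≤ (Subgroup.closure B).comap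
        (Groupoid.vertexGroupIsomOfMap (Groupoid.inv (τ i))).toMonoidHom :=
      hs i ▸ (Subgroup.closure_le _).mpr fun t ht =>
        Subgroup.subset_closure (.inl (mem_iUnion_of_mem i ⟨t, ht, rfl⟩))
    simpa using hle (hNK i hg)
  · obtain ⟨α, hα, β, hβ, hαβ⟩ := hNT i j a ha
    exact ⟨α, hα, β, hβ, Subgroup.subset_closure (.inr (mem_iUnion_of_mem (i, j) ⟨_, hαβ, rfl⟩))⟩

end GroupoidGeneration

section FundamentalGroupCover

variable {X : Type*} [TopologicalSpace X]

/-- The arrows of the fundamental groupoid of `X` represented by paths inside `V`. -/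
def pathsIn (V : Set X) : Subgroupoid (FundamentalGroupoid X) where
  arrows a b := {α | ∃ γ : Path a.as b.as, range γ ⊆ V ∧ .mk γ = α}
  inv := by
    rintro _ _ _ ⟨γ, hγ, rfl⟩
    exact ⟨γ.symm, γ.symm_range.trans_subset hγ, Path.Homotopic.Quotient.mk_symm γ⟩
  mul := by
    rintro _ _ _ _ ⟨γ, hγ, rfl⟩ _ ⟨δ, hδ, rfl⟩
    exact ⟨γ.trans δ, (γ.trans_range δ).trans_subset (union_subset hγ hδ),
      Path.Homotopic.Quotient.mk_trans γ δ⟩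

theorem pathsIn_mono {V W : Set X} (h : V ⊆ W) : pathsIn V ≤ pathsIn W :=
  (Subgroupoid.le_iff _ _).mpr fun ⟨γ, hγ, hα⟩ => ⟨γ, hγ.trans h, hα⟩

theorem nonempty_pathsIn {V : Set X} {a b : FundamentalGroupoid X} (h : JoinedIn V a.as b.as) :
    ((pathsIn V).arrows a b).Nonempty := by
  obtain ⟨γ, hγ⟩ := h
  exact ⟨.mk γ, γ, range_subset_iff.mpr hγ, rfl⟩

theorem eq_top_of_pathsIn_le {ι : Sort*} {U : ι → Set X} (hU : ∀ i, IsOpen (U i))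
    (hcov : ∀ a, ∃ i, a ∈ U i) (M : Subgroupoid (FundamentalGroupoid X))
    (hM : ∀ i, pathsIn (U i) ≤ M) : M = ⊤ := by
  refine eq_top_iff.mpr ((Subgroupoid.le_iff _ _).mpr fun {_ _} α _ => ?_)
  obtain ⟨γ, rfl⟩ := Path.Homotopic.Quotient.mk_surjective α
  let Good (s t : I) : Prop :=
    (.mk (γ.subpath s t) : FundamentalGroupoid.mk (γ s) ⟶ ⟨γ t⟩) ∈ M.arrows ⟨γ s⟩ ⟨γ t⟩
  have good_symm : Std.Symm Good := ⟨fun s t hst => by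
    simp only [Good, ← γ.symm_subpath s t, Path.Homotopic.Quotient.mk_symm]
    exact M.inv hst⟩
  have good_trans : IsTrans I Good := ⟨fun s t r hst htr => by
    have heq := Path.Homotopic.Quotient.eq.mpr ⟨Path.Homotopy.subpathTransSubpath γ s t r⟩
    simp only [Good, ← heq, Path.Homotopic.Quotient.mk_trans]
    exact M.mul hst htr⟩
  have good_near (s : I) : ∀ᶠ t in 𝓝 s, Good s t := by
    obtain ⟨i, hi⟩ := hcov (γ s)
    have hnhds : γ ⁻¹' U i ∈ 𝓝 s := γ.continuous.continuousAt ((hU i).mem_nhds hi)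
    have huIcc : Tendsto (uIcc s) (𝓝 s) (𝓝 s).smallSets :=
      tendsto_const_nhds.uIcc tendsto_id
    filter_upwards [huIcc.eventually (eventually_smallSets_subset.mpr hnhds)] with t ht
    exact (Subgroupoid.le_iff _ _).mp (hM i)
      ⟨_, (γ.range_subpath s t).trans_subset (image_subset_iff.mpr ht), rfl⟩
  have hγ := PreconnectedSpace.induction₂ Good good_near good_trans 0 1
  simp only [Good, γ.subpath_zero_one] at hγ
  have mem_of_cast {x y : X} (hx : x = _) (hy : y = _) :
      .mk (γ.cast hx hy) ∈ M.arrows ⟨x⟩ ⟨y⟩ → .mk γ ∈ M.arrows _ _ := by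
    subst hx hy
    exact id
  exact mem_of_cast γ.source γ.target hγ

theorem exists_subgroup_fg_pathsIn_subset {V : Set X} (x : V) [Group.FG (FundamentalGroup V x)] :
    ∃ K : Subgroup (FundamentalGroupoid.mk x.1 ⟶ ⟨x.1⟩), K.FG ∧ (pathsIn V).arrows ⟨x⟩ ⟨x⟩ ⊆ K := by
  have : Group.FG (FundamentalGroupoid.mk x ⟶ ⟨x⟩) := fg_end_iff_fg_vertexGroup.mp ‹_›
  refine ⟨((FundamentalGroupoid.map ⟨Subtype.val, continuous_subtype_val⟩).mapVertexGroup
    (FundamentalGroupoid.mk x)).range, (Group.fg_iff_subgroup_fg _).mp (Group.fg_range _), ?_⟩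
  rintro _ ⟨γ, hγ, rfl⟩
  let δ : Path x x :=
    { toFun := fun t => ⟨γ t, hγ (mem_range_self t)⟩
      source' := Subtype.ext γ.source
      target' := Subtype.ext γ.target }
  exact ⟨.mk δ, rfl⟩

theorem fundamentalGroup_fg_of_cover [PathConnectedSpace X] {ι : Type*} [Finite ι]
    {U V : ι → Set X} (hU : ∀ i, IsOpen (U i)) (hcov : ∀ a, ∃ i, a ∈ U i) (hUV : ∀ i, U i ⊆ V i)
    (hV : ∀ i, IsPathConnected (V i)) (hfg : ∀ i (x : V i), Group.FG (FundamentalGroup (V i) x))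
    (hinter : ∀ i j, ∃ Y : Set X, Y.Finite ∧ ∀ a ∈ U i ∩ U j, ∃ y ∈ Y, JoinedIn (V i ∩ V j) a y)
    (x₀ : X) : Group.FG (FundamentalGroup X x₀) := by
  choose x hx using fun i => (hV i).nonempty
  choose K hK_fg hK using fun i => exists_subgroup_fg_pathsIn_subset (⟨x i, hx i⟩ : V i)
  choose Y hY_fin hY using hinter
  have hne (i : ι) {a : FundamentalGroupoid X} (ha : a.as ∈ V i) :
      ((pathsIn (V i)).arrows ⟨x i⟩ a).Nonempty :=
    nonempty_pathsIn ((hV i).joinedIn _ (hx i) _ ha)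
  have hconn (a b : X) : Nonempty (FundamentalGroupoid.mk a ⟶ ⟨b⟩) :=
    ⟨.mk (PathConnectedSpace.somePath a b)⟩
  choose! β hβ using fun i (y : X) (hy : y ∈ V i) => hne i (a := ⟨y⟩) hy
  refine fg_end_iff_fg_vertexGroup.mpr <| fg_vertexGroup_of_subgroupoids
    (fun i => pathsIn (V i)) (fun i => {a | a.as ∈ U i}) (fun i => ⟨x i⟩)
    (fun i => hconn x₀ (x i)) (fun a => hcov a.as)
    (fun i a ha => hne i (hUV i ha)) (fun M hM => ?_) K hK_fg hK
    (fun i j => (fun y => β i y ≫ Groupoid.inv (β j y)) '' Y i j)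
    (fun i j => (hY_fin i j).image _) fun i j a ha => ?_
  · refine eq_top_of_pathsIn_le hU hcov M fun i => (Subgroupoid.le_iff _ _).mpr ?_
    rintro a b _ ⟨γ, hγ, rfl⟩
    exact hM i a (hγ ⟨0, γ.source⟩) b (hγ ⟨1, γ.target⟩) ⟨γ, hγ.trans (hUV i), rfl⟩
  · obtain ⟨y, hy, hay⟩ := hY i j a.as ha
    obtain ⟨δ, hδ⟩ := nonempty_pathsIn (b := ⟨y⟩) hay
    have hδi := (Subgroupoid.le_iff _ _).mp (pathsIn_mono inter_subset_left) hδ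
    have hδj := (Subgroupoid.le_iff _ _).mp (pathsIn_mono inter_subset_right) hδ
    exact ⟨_, (pathsIn (V i)).mul (hβ i y hay.target_mem.1) ((pathsIn _).inv hδi),
      _, (pathsIn (V j)).mul (hβ j y hay.target_mem.2) ((pathsIn _).inv hδj), y, hy, by simp⟩

end FundamentalGroupCover

section FinitelyGenerated

theorem fundamentalGroup_fg_of_homeomorph {X Y : Type*} [TopologicalSpace X] [TopologicalSpace Y]
    (h : X ≃ₜ Y) (hX : ∀ x, Group.FG (FundamentalGroup X x)) (y : Y) :
    Group.FG (FundamentalGroup Y y) := by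
  obtain ⟨x, rfl⟩ := h.surjective y
  refine Group.fg_of_surjective (f := FundamentalGroup.map (h : C(X, Y)) x) fun α => ?_
  obtain ⟨γ, rfl⟩ := Path.Homotopic.Quotient.mk_surjective α
  refine ⟨.mk ((γ.map h.symm.continuous).cast (by simp) (by simp)), ?_⟩
  refine congrArg Path.Homotopic.Quotient.mk (Path.ext (funext fun t => ?_))
  exact h.apply_symm_apply (γ t)

theorem fundamentalGroup_ne_zero_fg (z : {z : ℂ // z ≠ 0}) :
    Group.FG (FundamentalGroup {z : ℂ // z ≠ 0} z) := by
  let c := 2 * Real.pi * Complex.I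
  have : AddGroup.FG (AddSubgroup.zmultiples c) :=
    AddSubgroup.zmultiples_eq_closure c ▸ AddGroup.closure_finite_fg {c}
  let h := (MulEquiv.inv' _).trans (Complex.isAddQuotientCoveringMap_exp.fundamentalGroupEquiv
    (x := z) ⟨Complex.log z, Subtype.ext (Complex.exp_log z.2)⟩).symm
  exact Group.fg_of_surjective (f := h.toMonoidHom) h.surjective

variable {E S : Type*} [NormedAddCommGroup E] [NormedSpace ℝ E] [TopologicalSpace S]

theorem fundamentalGroup_preimage_val_range_fg {e : ℂ → S} (he : IsOpenEmbedding e) {P : Finset S}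
    (hP : ∀ z, e z ∈ P → z = 0) (x : (Subtype.val ⁻¹' range e : Set (Punctured S P))) :
    Group.FG (FundamentalGroup (Subtype.val ⁻¹' range e : Set (Punctured S P)) x) := by
  let h : {z // e z ∉ P} ≃ₜ (Subtype.val ⁻¹' range e : Set (Punctured S P)) :=
    (he.isEmbedding.restrictPreimage {y | y ∉ P}).toHomeomorph.trans
      (.setCongr (range_restrictPreimage _ _))
  refine fundamentalGroup_fg_of_homeomorph h (fun z => ?_) x
  by_cases h0 : e 0 ∈ P
  · have hset : {z | z ≠ 0} = {z | e z ∉ P} :=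
      Set.ext fun z => not_congr ⟨fun hz => hz ▸ h0, hP z⟩
    exact fundamentalGroup_fg_of_homeomorph (.setCongr hset) fundamentalGroup_ne_zero_fg z
  · have hset : univ = {z | e z ∉ P} :=
      (eq_univ_of_forall fun z hz => h0 (hP z hz ▸ hz)).symm
    exact fundamentalGroup_fg_of_homeomorph ((Homeomorph.Set.univ ℂ).symm.trans (.setCongr hset))
      (fun _ => inferInstance) z

theorem exists_finite_joinedIn_preimage_val (hE : 1 < Module.rank ℝ E) [ChartedSpace E S]
    (P : Finset S) {K O : Set S} (hK : IsCompact K) (hO : IsOpen O) (hKO : K ⊆ O) :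
    ∃ Y : Set (Punctured S P), Y.Finite ∧
      ∀ a : Punctured S P, (a : S) ∈ K → ∃ y ∈ Y, JoinedIn (Subtype.val ⁻¹' O) a y := by
  refine hK.induction_on (p := fun K => ∃ Y : Set (Punctured S P), Y.Finite ∧
      ∀ a : Punctured S P, (a : S) ∈ K → ∃ y ∈ Y, JoinedIn (Subtype.val ⁻¹' O) a y)
    ⟨∅, finite_empty, by simp⟩ ?_ ?_ ?_
  · rintro K L hKL ⟨Y, hY, hYL⟩
    exact ⟨Y, hY, fun a ha => hYL a (hKL ha)⟩
  · rintro K L ⟨Y, hY, hYK⟩ ⟨Z, hZ, hZL⟩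
    refine ⟨Y ∪ Z, hY.union hZ, fun a ha => ?_⟩
    rcases ha with ha | ha
    · exact (hYK a ha).imp fun y hy => ⟨.inl hy.1, hy.2⟩
    · exact (hZL a ha).imp fun y hy => ⟨.inr hy.1, hy.2⟩
  · intro x hx
    obtain ⟨e, he, rfl, heO⟩ :=
      exists_isOpenEmbedding_range_subset (E := E) (hO.mem_nhds (hKO hx))
    have hpath := isPathConnected_preimage_val_range hE he.continuous he.injective P
    obtain ⟨y, hy⟩ := hpath.nonempty
    refine ⟨range e, mem_nhdsWithin_of_mem_nhds (he.isOpen_range.mem_nhds (mem_range_self 0)), {y},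
      finite_singleton y, fun a ha => ⟨y, rfl, ?_⟩⟩
    exact (hpath.joinedIn a ha y hy).mono (preimage_mono heO)

theorem exists_isOpenEmbedding_mem_imp_eq_zero [T2Space S] [ChartedSpace E S] (P : Finset S)
    (y : S) : ∃ e : E → S, IsOpenEmbedding e ∧ e 0 = y ∧ ∀ z, e z ∈ P → z = 0 := by
  obtain ⟨e, he, rfl, heP⟩ := exists_isOpenEmbedding_range_subset (E := E)
    ((P.finite_toSet.sdiff (t := {y})).isClosed.compl_mem_nhds (by simp : y ∉ _))
  exact ⟨e, he, rfl, fun z hz =>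
    he.injective <| by_contra fun h0 => heP (mem_range_self z) ⟨hz, h0⟩⟩

theorem fundamentalGroup_punctured_fg [T2Space S] [CompactSpace S] [ChartedSpace ℂ S] (P : Finset S)
    [PathConnectedSpace (Punctured S P)] (x₀ : Punctured S P) :
    Group.FG (FundamentalGroup (Punctured S P) x₀) := by
  have hℂ : 1 < Module.rank ℝ ℂ := Complex.rank_real_complex ▸ Nat.one_lt_ofNat
  choose e he he0 heP using exists_isOpenEmbedding_mem_imp_eq_zero (E := ℂ) P
  obtain ⟨t, -, ht⟩ := isCompact_univ.elim_nhds_subcover (fun y => e y '' Metric.ball 0 1)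
    fun y _ => by
      simpa only [he0] using (he y).isOpenMap.image_mem_nhds (Metric.ball_mem_nhds 0 one_pos)
  refine fundamentalGroup_fg_of_cover (ι := t)
    (U := fun y => Subtype.val ⁻¹' (e y '' Metric.ball 0 1))
    (V := fun y => Subtype.val ⁻¹' range (e y))
    (fun y => ((he y).isOpenMap _ Metric.isOpen_ball).preimage continuous_subtype_val)
    (fun a => ?_) (fun y => preimage_mono (image_subset_range _ _))
    (fun y => isPathConnected_preimage_val_range hℂ (he y).continuous (he y).injective P)
    (fun y => fundamentalGroup_preimage_val_range_fg (he y) (heP y)) (fun y z => ?_) x₀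
  · obtain ⟨y, hyt, hay⟩ := mem_iUnion₂.mp (ht (mem_univ (a : S)))
    exact ⟨⟨y, hyt⟩, hay⟩
  · have hcompact (y : S) : IsCompact (e y '' Metric.closedBall 0 1) :=
      (isCompact_closedBall 0 1).image (he y).continuous
    obtain ⟨Y, hY, hYjoin⟩ := exists_finite_joinedIn_preimage_val hℂ P
      ((hcompact y).inter (hcompact z)) ((he y).isOpen_range.inter (he z).isOpen_range)
      (inter_subset_inter (image_subset_range _ _) (image_subset_range _ _))
    exact ⟨Y, hY, fun a ha => hYjoin a
      (inter_subset_inter (image_mono Metric.ball_subset_closedBall)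
        (image_mono Metric.ball_subset_closedBall) ha)⟩

end FinitelyGenerated

section MovedPuncture

variable {S : Type*} [TopologicalSpace S] [T2Space S] [ChartedSpace ℂ S] {P : Finset S}
  [ConnectedSpace (Punctured S P)] {o : SurfaceOrientation (Punctured S P)}
  {f : Punctured S P ≃ₜ Punctured S P} {p q : S}

theorem exists_windingHom_of_tendsto_punctureFilter (hf : f ∈ homeoPlus o) (hp : p ∈ P) (hq : q ∈ P)
    (hpq : p ≠ q) (hfpq : Tendsto f (punctureFilter P p) (punctureFilter P q)) {x₀ : Punctured S P}
    (γ : FundamentalGroupoid.mk x₀ ⟶ FundamentalGroupoid.mk (f x₀)) :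
    ∃ (φ : FundamentalGroup (Punctured S P) x₀ →* Multiplicative ℤ) (α : _),
      φ α = .ofAdd 1 ∧ φ (pushAut f γ α) = .ofAdd (-1) := by
  have : PreconnectedSpace S :=
    preconnectedSpace_of_punctured (Complex.rank_real_complex ▸ Nat.one_lt_ofNat) P
  obtain ⟨e, he, ⟨a, rfl⟩, b, rfl⟩ := exists_isOpenEmbedding_pair_mem_range (E := ℂ) p q
  obtain ⟨y, β, hβ, hfβ⟩ :=
    exists_logIncrement_punctureQuotient hf he hp hq (ne_of_apply_ne e hpq) hfpq
  exact ⟨_, exists_windingHom_eq_of_logIncrement _ f γ β hβ hfβ⟩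

theorem eq_of_outQuotient_pushAut_eq_one (hf : f ∈ homeoPlus o) (hp : p ∈ P) (hq : q ∈ P)
    (hfpq : Tendsto f (punctureFilter P p) (punctureFilter P q)) {x₀ : Punctured S P}
    (γ : FundamentalGroupoid.mk x₀ ⟶ FundamentalGroupoid.mk (f x₀))
    {K : Subgroup (FundamentalGroup (Punctured S P) x₀)} [K.Characteristic]
    (hK : K ≤ commonKernel _ (Multiplicative (ZMod 3)))
    (h : outQuotient K (QuotientGroup.mk (pushAut f γ)) = 1) : p = q := by
  by_contra hpq
  obtain ⟨φ, α, hα, hfα⟩ := exists_windingHom_of_tendsto_punctureFilter hf hp hq hpq hfpq γ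
  have hmod := map_eq_of_outQuotient_eq_one hK h
    ((AddMonoidHom.toMultiplicative (Int.castAddHom (ZMod 3))).comp φ) α
  simp only [MonoidHom.comp_apply, hα, hfα] at hmod
  have hcast : ((-1 : ℤ) : ZMod 3) = ((1 : ℤ) : ZMod 3) := hmod
  exact absurd hcast (by decide)

end MovedPuncture

end

theorem mainTheorem4_general {S : Type*} [TopologicalSpace S] [T2Space S] [CompactSpace S]
    [ChartedSpace ℂ S] (P : Finset S) [ConnectedSpace (Punctured S P)]
    (o : SurfaceOrientation (Punctured S P)) (x₀ : Punctured S P) :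
    IsCongruenceSubgroup (outerAction o x₀) (pureMappingClassGroup P o) := by
  have hfg := fundamentalGroup_punctured_fg P x₀
  have hchar := commonKernel_characteristic (FundamentalGroup (Punctured S P) x₀)
    (Multiplicative (ZMod 3))
  refine ⟨_, hchar, commonKernel_finiteIndex _ _, fun m hm => ?_⟩
  obtain ⟨f, rfl⟩ := QuotientGroup.mk_surjective m
  refine ⟨f, fun p hp => ?_, rfl⟩
  obtain ⟨q, hq, hfpq⟩ :=
    exists_map_punctureFilter_eq (Complex.rank_real_complex ▸ Nat.one_lt_ofNat) f.1 hp
  rwa [← eq_of_outQuotient_pushAut_eq_one f.2 hp hq hfpq.le _ le_rfl hm] at hfpq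

theorem mainTheorem4 {S : Type*} [TopologicalSpace S] [T2Space S] [CompactSpace S]
    [ChartedSpace ℂ S] (P : Finset S) [ConnectedSpace (Punctured S P)]
    (o : SurfaceOrientation (Punctured S P)) (x₀ : Punctured S P)
    (hyperbolic : eulerCharPunctured P (x₀ : S) < 0) :
    IsCongruenceSubgroup (outerAction o x₀) (pureMappingClassGroup P o) :=
  mainTheorem4_general P o x₀
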